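/- For a monoid $S$, regard $\mathbb{Z}$ as the trivial left $\mathbb{Z}S$-module via the augmentation $\epsilon_S:\mathbb{Z}S\to\mathbb{Z}$, $s\mapsto 1$ ($s\in S$). The monoid $S$ is of type left-$\mathrm{FP}_n$ if there is an exact sequence of left $\mathbb{Z}S$-modules $$A_n\to A_{n-1}\to\cdots\to A_1\to A_0\to\mathbb{Z}\to 0$$ with $A_0,\dots,A_n$ all free and finitely generated. A semigroup $U$ without a two-sided identity element is of type left-$\mathrm{FP}_n$ if the monoid $U^1$, obtained from $U$ by adjoining an identity element, is of type left-$\mathrm{FP}_n$; a semigroup with a two-sided identity is treated as a monoid. For groups left- and right-$\mathrm{FP}_n$ coincide, and one speaks of type $\mathrm{FP}_n$. Ideals are understood to be nonempty. A (nonempty) semigroup is completely simple if it has no proper two-sided ideals and has minimal left ideals and minimal right ideals. The maximal subgroup containing an idempotent $e$ of $U$ is the group of units of the monoid $eUe$. **Theorem.** Let $n\geq 1$, let $U$ be a completely simple semigroup with finitely many left ideals, and let $H$ be a maximal subgroup of $U$. Then $U$ is of type left-$\mathrm{FP}_n$ if and only if $U$ has finitely many right ideals and the group $H$ is of type $\mathrm{FP}_n$.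 -/

import Mathlib

universe u

namespace SemigroupHomology

/-! ### The trivial module and the property left-`FP_n` for monoids -/

/-- The standard augmentation `ε_S : ℤS → ℤ`, the ring homomorphism with `s ↦ 1` for `s ∈ S`. -/
noncomputable def augmentation (S : Type u) [Monoid S] : MonoidAlgebra ℤ S →+* ℤ :=
  (MonoidAlgebra.lift ℤ ℤ S (1 : S →* ℤ)).toRingHom

theorem augmentation_of (S : Type u) [Monoid S] (s : S) :
    augmentation S (MonoidAlgebra.of ℤ S s) = 1 := by
  simp [augmentation]

/-- The underlying abelian group `ℤ` of the trivial left `ℤS`-module. -/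
def TrivialModule (S : Type u) [Monoid S] : Type := ℤ

instance (S : Type u) [Monoid S] : AddCommGroup (TrivialModule S) :=
  inferInstanceAs (AddCommGroup ℤ)

/-- The action `r • z = ε_S(r) z` of `ℤS` on `ℤ`. -/
noncomputable instance (S : Type u) [Monoid S] :
    Module (MonoidAlgebra ℤ S) (TrivialModule S) :=
  Module.compHom ℤ (augmentation S)

/-- A partial free resolution
`A_n → A_{n-1} → ⋯ → A_1 → A_0 → ℤ → 0` of the trivial left `ℤS`-module `ℤ`.
The modules and maps beyond degree `n` are unconstrained and play no role. -/
structure PartialFreeResolution (S : Type u) [Monoid S] (n : ℕ) where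
  /-- the modules `A_0, A_1, …, A_n` -/
  A : ℕ → Type u
  [addCommGroup : ∀ i, AddCommGroup (A i)]
  [module : ∀ i, Module (MonoidAlgebra ℤ S) (A i)]
  /-- the map `∂_0 : A_0 → ℤ` -/
  aug : A 0 →ₗ[MonoidAlgebra ℤ S] TrivialModule S
  /-- the maps `∂_{i+1} : A_{i+1} → A_i` -/
  d : ∀ i, A (i + 1) →ₗ[MonoidAlgebra ℤ S] A i
  free : ∀ i ≤ n, Module.Free (MonoidAlgebra ℤ S) (A i)
  aug_surjective : Function.Surjective aug
  exact_zero : 0 < n → Function.Exact (d 0) aug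
  exact_succ : ∀ i, i + 1 < n → Function.Exact (d (i + 1)) (d i)

attribute [instance] PartialFreeResolution.addCommGroup PartialFreeResolution.module

/-- The monoid `S` is of type left-`FP_n`: there is a partial free resolution of the trivial left
`ℤS`-module `ℤ` in which `A_0, …, A_n` are all finitely generated. -/
def IsLeftFPMonoid (S : Type u) [Monoid S] (n : ℕ) : Prop :=
  ∃ P : PartialFreeResolution S n, ∀ i ≤ n, Module.Finite (MonoidAlgebra ℤ S) (P.A i)

/-- The group `G` is of type `FP_n`. (For groups, left-`FP_n` and right-`FP_n` agree,
by inverting the elements of `G`.) -/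
def IsFPGroup (G : Type u) [Group G] (n : ℕ) : Prop :=
  IsLeftFPMonoid G n

/-! ### The property left-`FP_n` for semigroups -/

/-- `e` is a two-sided identity element of `U`. -/
def IsTwoSidedIdentity {U : Type u} [Semigroup U] (e : U) : Prop :=
  ∀ x : U, e * x = x ∧ x * e = x

/-- A semigroup with a two-sided identity element, regarded as a monoid. -/
abbrev monoidOfIdentity {U : Type u} [Semigroup U] (e : U) (he : IsTwoSidedIdentity e) :
    Monoid U where
  one := e
  one_mul x := (he x).1
  mul_one x := (he x).2

/-- The semigroup `U` is of type left-`FP_n`: if `U` has a two-sided identity element, then the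
monoid `U` is of type left-`FP_n`; if it has none, then the monoid `U¹`, obtained from `U` by
adjoining an identity element, is of type left-`FP_n`. -/
def IsLeftFP (U : Type u) [Semigroup U] (n : ℕ) : Prop :=
  (∃ (e : U) (he : IsTwoSidedIdentity e), @IsLeftFPMonoid U (monoidOfIdentity e he) n) ∨
    ((¬ ∃ e : U, IsTwoSidedIdentity e) ∧ IsLeftFPMonoid (WithOne U) n)

/-! ### Ideals and completely simple semigroups -/

/-- A left ideal of `U`: a nonempty subset `I` with `U I ⊆ I`. -/
def IsLeftIdeal {U : Type u} [Semigroup U] (I : Set U) : Prop :=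
  I.Nonempty ∧ ∀ s : U, ∀ x ∈ I, s * x ∈ I

/-- A right ideal of `U`: a nonempty subset `I` with `I U ⊆ I`. -/
def IsRightIdeal {U : Type u} [Semigroup U] (I : Set U) : Prop :=
  I.Nonempty ∧ ∀ s : U, ∀ x ∈ I, x * s ∈ I

/-- A semigroup is simple if it is nonempty and has no proper two-sided ideals. -/
def IsSimple (U : Type u) [Semigroup U] : Prop :=
  Nonempty U ∧ ∀ I : Set U, IsLeftIdeal I → IsRightIdeal I → I = Set.univ

/-- A semigroup is completely simple if it is simple and has minimal left and right ideals. -/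
def IsCompletelySimple (U : Type u) [Semigroup U] : Prop :=
  IsSimple U ∧ (∃ L : Set U, Minimal IsLeftIdeal L) ∧ (∃ R : Set U, Minimal IsRightIdeal R)

/-! ### Maximal subgroups -/

/-- The submonoid `eUe` of the semigroup `U`, for an idempotent `e`; its identity is `e`. -/
def LocalMonoid {U : Type u} [Semigroup U] {e : U} (_he : IsIdempotentElem e) : Type u :=
  Subsemigroup.corner e

instance {U : Type u} [Semigroup U] {e : U} (he : IsIdempotentElem e) :
    Monoid (LocalMonoid he) where
  __ : Semigroup (LocalMonoid he) := inferInstanceAs (Semigroup (Subsemigroup.corner e))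
  one := ⟨e, e, by simp only [he.eq]⟩
  one_mul x := Subtype.ext ((Subsemigroup.mem_corner_iff he).mp x.2).1
  mul_one x := Subtype.ext ((Subsemigroup.mem_corner_iff he).mp x.2).2

/-- The maximal subgroup of `U` containing the idempotent `e`: the group of units of `eUe`. -/
abbrev MaximalSubgroup {U : Type u} [Semigroup U] {e : U} (he : IsIdempotentElem e) : Type u :=
  (LocalMonoid he)ˣ

end SemigroupHomology

/-!
Let `S` be the monoid attached to `U`: either `U` itself or `U` with an identity adjoined. In both
cases `S = T ∪ {1}` for an ideal `T` isomorphic to `U`, and `T` is completely simple, which is used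
only through the relations `x ∈ x * y * S` and `x ∈ S * y * x` for `x, y ∈ T` (`IsSimpleIdeal`).
The idempotent `e` lies in `T` and `H = eSe`. Type left-`FP_n` for `S` is type `FP_n` for the
trivial `ℤS`-module, where `FP_n` for modules (`IsFPModule`) is defined with finitely generated
projective modules and is stable under extensions and suitable quotients.

If `S` is of type left-`FP_n`, apply the exact functor `M ↦ eM` from `ℤS`-modules to `ℤH`-modules
to a resolution. It fixes the trivial module, and it sends `ℤS` to `ℤ(eS)`. The group `H` permutes
`eS` freely with one orbit for each minimal left ideal of `U`, so `ℤ(eS)` is free of finite rank and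
`H` is of type `FP_n` (`OrbitTransversal.isLeftFPMonoid`). Moreover the augmentation ideal of `ℤS` is
finitely generated, which forces `S` to have finitely many principal right ideals
(`IsSimpleIdeal.finite_range_principalRight`).

Conversely, let `H` be of type `FP_n` and let `U` have finitely many right ideals. Induction
`N ↦ ℤ(Se) ⊗ N` from `ℤH`-modules to `ℤS`-modules is exact, because `H` acts freely on `Se`, and it
sends `ℤH` to the projective module `ℤSe`. Hence the module induced from the trivial one is of type
`FP_n` (`RightTransversal.isFPModule_induced`). It maps onto the trivial `ℤS`-module. The kernel has
finitely generated additive group, as `Se` consists of finitely many `H`-orbits, and it is annihilated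
by `T`, because left multiplication by an element of `T` moves all of `Se` into one orbit. Such modules
are of type `FP_m` for every `m` (`IsSimpleIdeal.isFPModule_of_annihilated`): the module `ℤS / ℤT` is,
since `ℤT` is a finite direct sum of modules `ℤSf` with `f` idempotent. So the trivial `ℤS`-module is
of type `FP_n`.
-/

namespace SemigroupHomology

/-! ### Modules of type `FP_n` -/

open Function

/-- The left `R`-module `M` is of type `FP_n`: it admits a partial resolution of length `n` by
finitely generated projective modules. The recursion peels off one syzygy at a time. -/
def IsFPModule (R : Type u) [Ring R] :
    ℕ → ∀ (M : Type u) [AddCommGroup M] [Module R M], Prop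
  | 0, M, _, _ => Module.Finite R M
  | n + 1, M, _, _ => ∃ (P : Type u) (_ : AddCommGroup P) (_ : Module R P) (f : P →ₗ[R] M),
      Module.Finite R P ∧ Module.Projective R P ∧ Surjective f ∧ IsFPModule R n (LinearMap.ker f)

namespace IsFPModule

variable {R : Type u} [Ring R] {X Y Z P : Type u}
  [AddCommGroup X] [Module R X] [AddCommGroup Y] [Module R Y] [AddCommGroup Z] [Module R Z]
  [AddCommGroup P] [Module R P]

theorem of_equiv {n : ℕ} (h : IsFPModule R n X) (e : X ≃ₗ[R] Y) : IsFPModule R n Y := by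
  cases n with
  | zero =>
    have : Module.Finite R X := h
    exact Module.Finite.equiv e
  | succ n =>
    obtain ⟨P, _, _, f, hP, hP', hf, hk⟩ := h
    refine ⟨P, _, _, e.toLinearMap ∘ₗ f, hP, hP', e.surjective.comp hf, ?_⟩
    rwa [LinearMap.ker_comp, LinearEquiv.ker, Submodule.comap_bot]

/-- Presenting `M` by a finitely generated projective module, with kernel given up to
isomorphism. -/
theorem of_exact {n : ℕ} [Module.Finite R P] [Module.Projective R P]
    (i : X →ₗ[R] P) (f : P →ₗ[R] Y) (hi : Injective i) (hif : Exact i f) (hf : Surjective f)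
    (hX : IsFPModule R n X) : IsFPModule R (n + 1) Y :=
  ⟨P, _, _, f, ‹_›, ‹_›, hf, hX.of_equiv <|
    (LinearEquiv.ofInjective i hi).trans <| LinearEquiv.ofEq _ _ (LinearMap.exact_iff.mp hif).symm⟩

theorem finite {n : ℕ} (h : IsFPModule R n X) : Module.Finite R X := by
  cases n with
  | zero => exact h
  | succ n =>
    obtain ⟨P, _, _, f, hP, -, hf, -⟩ := h
    exact Module.Finite.of_surjective f hf

theorem of_subsingleton (n : ℕ) : ∀ (X : Type u) [AddCommGroup X] [Module R X] [Subsingleton X],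
    IsFPModule R n X := by
  induction n with
  | zero => intro X _ _ _; exact (inferInstance : Module.Finite R X)
  | succ n ih =>
    intro X _ _ _
    exact ⟨X, _, _, LinearMap.id, inferInstance, inferInstance, surjective_id, ih _⟩

theorem of_projective (n : ℕ) [Module.Finite R P] [Module.Projective R P] :
    IsFPModule R n P := by
  cases n with
  | zero => exact (inferInstance : Module.Finite R P)
  | succ n =>
    refine ⟨P, _, _, LinearMap.id, ‹_›, ‹_›, surjective_id, ?_⟩
    rw [LinearMap.ker_id]
    exact of_subsingleton n _

/-- An extension of modules of type `FP_n` is of type `FP_n`: the horseshoe construction gives a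
presentation of `Y` by `P × Q` whose kernel is again such an extension. -/
theorem of_extension (n : ℕ) : ∀ {X Y Z : Type u}
    [AddCommGroup X] [Module R X] [AddCommGroup Y] [Module R Y] [AddCommGroup Z] [Module R Z]
    (f : X →ₗ[R] Y) (g : Y →ₗ[R] Z), Injective f → Exact f g → Surjective g →
    IsFPModule R n X → IsFPModule R n Z → IsFPModule R n Y := by
  induction n with
  | zero =>
    intro X Y Z _ _ _ _ _ _ f g hf hfg hg hX hZ
    have : Module.Finite R X := hX
    have : Module.Finite R Z := hZ
    refine ⟨Submodule.fg_of_fg_map_of_fg_inf_ker g ?_ ?_⟩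
    · rw [Submodule.map_top, LinearMap.range_eq_top.mpr hg]
      exact Module.Finite.fg_top
    · rw [top_inf_eq, LinearMap.exact_iff.mp hfg, ← Module.Finite.iff_fg]
      infer_instance
  | succ n ih =>
    intro X Y Z _ _ _ _ _ _ f g hf hfg hg hX hZ
    obtain ⟨P, _, _, p, hPf, hPp, hp, hPk⟩ := hX
    obtain ⟨Q, _, _, q, hQf, hQp, hq, hQk⟩ := hZ
    obtain ⟨l, hl⟩ := Module.projective_lifting_property g q hg
    have hgl : ∀ b, g (l b) = q b := fun b => LinearMap.congr_fun hl b
    have hgf : ∀ x, g (f x) = 0 := hfg.apply_apply_eq_zero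
    let F : P × Q →ₗ[R] Y := (f ∘ₗ p).coprod l
    have hF : ∀ a b, F (a, b) = f (p a) + l b := fun a b => rfl
    refine ⟨P × Q, _, _, F, inferInstance, inferInstance, ?_, ?_⟩
    · intro y
      obtain ⟨b, hb⟩ := hq (g y)
      obtain ⟨x, hx⟩ := (hfg (y - l b)).mp (by rw [map_sub, hgl, hb, sub_self])
      obtain ⟨a, rfl⟩ := hp x
      exact ⟨(a, b), by rw [hF, hx]; abel⟩
    · let i : LinearMap.ker p →ₗ[R] LinearMap.ker F :=
        ((LinearMap.inl R P Q).restrict (p := LinearMap.ker p) (q := LinearMap.ker F) (by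
          intro a ha
          rw [LinearMap.mem_ker] at ha ⊢
          simp [hF, ha]))
      let r : LinearMap.ker F →ₗ[R] LinearMap.ker q :=
        ((LinearMap.snd R P Q).restrict (p := LinearMap.ker F) (q := LinearMap.ker q) (by
          rintro ⟨a, b⟩ hab
          rw [LinearMap.mem_ker] at hab ⊢
          have := congrArg g hab
          rwa [hF, map_add, hgf, zero_add, hgl, map_zero] at this))
      refine ih i r ?_ ?_ ?_ hPk hQk
      · rintro ⟨a, ha⟩ ⟨b, hb⟩ hab
        have := congrArg (fun z => z.1.1) hab
        exact Subtype.ext this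
      · rintro ⟨⟨a, b⟩, hab⟩
        constructor
        · intro h
          have hb : b = 0 := congrArg Subtype.val h
          subst hb
          have ha : p a = 0 := hf (by
            rw [LinearMap.mem_ker, hF, map_zero, add_zero] at hab
            rw [hab, map_zero])
          exact ⟨⟨a, ha⟩, rfl⟩
        · rintro ⟨⟨a', ha'⟩, h⟩
          have : (0 : Q) = b := congrArg (fun z => z.1.2) h
          exact Subtype.ext this.symm
      · rintro ⟨b, hb⟩
        obtain ⟨x, hx⟩ := (hfg (l b)).mp (by rw [hgl]; exact hb)
        obtain ⟨a, ha⟩ := hp (-x)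
        refine ⟨⟨(a, b), ?_⟩, rfl⟩
        rw [LinearMap.mem_ker, hF, ha, map_neg, hx, neg_add_cancel]

/-- If `X` is of type `FP_n` and `Y` of type `FP_{n+1}`, then so is the quotient `Z = Y / X`. -/
theorem of_quotient_succ {n : ℕ} (f : X →ₗ[R] Y) (g : Y →ₗ[R] Z) (hf : Injective f)
    (hfg : Exact f g) (hg : Surjective g) (hX : IsFPModule R n X) (hY : IsFPModule R (n + 1) Y) :
    IsFPModule R (n + 1) Z := by
  obtain ⟨P, _, _, p, hPf, hPp, hp, hPk⟩ := hY
  refine ⟨P, _, _, g ∘ₗ p, hPf, hPp, hg.comp hp, ?_⟩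
  -- the kernel of `P → Y → Z` is an extension of `X ≅ ker g` by the kernel of `P → Y`
  have hX' : IsFPModule R n (LinearMap.ker g) := hX.of_equiv <|
    (LinearEquiv.ofInjective f hf).trans <| LinearEquiv.ofEq _ _ (LinearMap.exact_iff.mp hfg).symm
  let i : LinearMap.ker p →ₗ[R] LinearMap.ker (g ∘ₗ p) :=
    Submodule.inclusion (LinearMap.ker_le_ker_comp p g)
  let r : LinearMap.ker (g ∘ₗ p) →ₗ[R] LinearMap.ker g :=
    p.restrict (p := LinearMap.ker (g ∘ₗ p)) (q := LinearMap.ker g) (fun a ha => ha)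
  refine of_extension n i r (Submodule.inclusion_injective _) ?_ ?_ hPk hX'
  · rintro ⟨a, ha⟩
    constructor
    · intro h
      exact ⟨⟨a, congrArg Subtype.val h⟩, rfl⟩
    · rintro ⟨⟨b, hb⟩, h⟩
      have : b = a := congrArg Subtype.val h
      subst this
      exact Subtype.ext hb
  · rintro ⟨y, hy⟩
    obtain ⟨a, rfl⟩ := hp y
    exact ⟨⟨a, hy⟩, rfl⟩

/-- In the definition of type `FP_{n+1}` the first module of the resolution may be taken free. -/
theorem exists_free {n : ℕ} (h : IsFPModule R (n + 1) X) :
    ∃ (k : ℕ) (f : (Fin k → R) →ₗ[R] X), Surjective f ∧ IsFPModule R n (LinearMap.ker f) := by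
  obtain ⟨P, _, _, p, hPf, hPp, hp, hPk⟩ := h
  obtain ⟨k, c, hc⟩ := Module.Finite.exists_fin' R P
  refine ⟨k, p ∘ₗ c, hp.comp hc, ?_⟩
  -- `ker c` is a direct summand of the free module, hence finitely generated projective
  obtain ⟨s, hs⟩ := Module.projective_lifting_property c LinearMap.id hc
  have hcs : ∀ x, c (s x) = x := fun x => LinearMap.congr_fun hs x
  let t : (Fin k → R) →ₗ[R] LinearMap.ker c :=
    (LinearMap.id - s ∘ₗ c).codRestrict _ (fun x => by simp [hcs])
  have ht : t ∘ₗ (LinearMap.ker c).subtype = LinearMap.id := by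
    ext ⟨x, hx⟩
    have hx' : c x = 0 := hx
    simp [t, hx']
  have : Module.Projective R (LinearMap.ker c) := Module.Projective.of_split _ t ht
  have : Module.Finite R (LinearMap.ker c) :=
    Module.Finite.of_surjective t (fun x => ⟨x.1, LinearMap.congr_fun ht x⟩)
  let i : LinearMap.ker c →ₗ[R] LinearMap.ker (p ∘ₗ c) :=
    Submodule.inclusion (LinearMap.ker_le_ker_comp c p)
  let r : LinearMap.ker (p ∘ₗ c) →ₗ[R] LinearMap.ker p :=
    c.restrict (p := LinearMap.ker (p ∘ₗ c)) (q := LinearMap.ker p) (fun a ha => ha)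
  refine of_extension n i r (Submodule.inclusion_injective _) ?_ ?_ (of_projective n) hPk
  · rintro ⟨a, ha⟩
    constructor
    · intro h
      exact ⟨⟨a, congrArg Subtype.val h⟩, rfl⟩
    · rintro ⟨⟨b, hb⟩, h⟩
      have : b = a := congrArg Subtype.val h
      subst this
      exact Subtype.ext hb
  · rintro ⟨y, hy⟩
    obtain ⟨a, rfl⟩ := hc y
    exact ⟨⟨a, hy⟩, rfl⟩

/-- A partial resolution by finitely generated free modules exhibits type `FP_n`. -/
theorem of_resolution (n : ℕ) : ∀ {M : Type u} [AddCommGroup M] [Module R M]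
    (A : ℕ → Type u) [∀ i, AddCommGroup (A i)] [∀ i, Module R (A i)]
    (aug : A 0 →ₗ[R] M) (d : ∀ i, A (i + 1) →ₗ[R] A i),
    (∀ i ≤ n, Module.Finite R (A i)) → (∀ i ≤ n, Module.Free R (A i)) → Surjective aug →
    (0 < n → Exact (d 0) aug) → (∀ i, i + 1 < n → Exact (d (i + 1)) (d i)) →
    IsFPModule R n M := by
  induction n with
  | zero =>
    intro M _ _ A _ _ aug d hfin _ hs _ _
    have := hfin 0 le_rfl
    exact Module.Finite.of_surjective aug hs
  | succ n ih =>
    intro M _ _ A _ _ aug d hfin hfree hs h0 h1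
    have := hfin 0 (Nat.zero_le _)
    have := hfree 0 (Nat.zero_le _)
    have h0 := h0 n.succ_pos
    refine ⟨A 0, _, _, aug, ‹_›, inferInstance, hs, ?_⟩
    refine ih (fun i => A (i + 1))
      ((d 0).codRestrict (LinearMap.ker aug) h0.apply_apply_eq_zero) (fun i => d (i + 1))
      (fun i hi => hfin _ (by omega)) (fun i hi => hfree _ (by omega)) ?_ ?_
      (fun i hi => h1 _ (by omega))
    · rintro ⟨y, hy⟩
      obtain ⟨x, hx⟩ := (h0 y).mp hy
      exact ⟨x, Subtype.ext hx⟩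
    · intro hn x
      rw [← h1 0 (by omega) x, ← Subtype.val_inj]
      rfl

/-- A module of type `FP_n` has a partial resolution by free modules of finite rank. -/
theorem exists_resolution (n : ℕ) : ∀ {M : Type u} [AddCommGroup M] [Module R M],
    IsFPModule R n M → ∃ (k : ℕ → ℕ) (aug : (Fin (k 0) → R) →ₗ[R] M)
      (d : ∀ i, (Fin (k (i + 1)) → R) →ₗ[R] (Fin (k i) → R)), Surjective aug ∧
      (0 < n → Exact (d 0) aug) ∧ ∀ i, i + 1 < n → Exact (d (i + 1)) (d i) := by
  induction n with
  | zero =>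
    intro M _ _ h
    have : Module.Finite R M := h
    obtain ⟨k, f, hf⟩ := Module.Finite.exists_fin' R M
    exact ⟨fun _ => k, f, fun _ => 0, hf, by simp, by simp⟩
  | succ n ih =>
    intro M _ _ h
    obtain ⟨k₀, f, hf, hk⟩ := h.exists_free
    obtain ⟨k, aug, d, hs, h0, h1⟩ := ih hk
    refine ⟨fun i => Nat.casesOn i k₀ k, f,
      fun i => Nat.casesOn i ((LinearMap.ker f).subtype ∘ₗ aug) d, hf, fun _ => ?_, ?_⟩
    · intro x
      constructor
      · intro hx
        obtain ⟨y, hy⟩ := hs ⟨x, hx⟩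
        exact ⟨y, congrArg Subtype.val hy⟩
      · rintro ⟨y, rfl⟩
        exact (aug y).2
    · rintro (_ | i) hi x
      · rw [← h0 (by omega) x]
        exact Subtype.val_inj (b := (0 : LinearMap.ker f))
      · exact h1 i (by omega) x

end IsFPModule

/-! ### Modules over integral monoid rings -/

section MonoidRing

open Function

variable {S : Type u} [Monoid S]

/-- The integral monoid ring `ℤS`. -/
abbrev MonoidRing (S : Type u) [Monoid S] : Type u := MonoidAlgebra ℤ S

/-- The element of `ℤS` given by `s ∈ S`. -/
noncomputable abbrev basisElt (s : S) : MonoidRing S := MonoidAlgebra.of ℤ S s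

theorem basisElt_one : basisElt (1 : S) = 1 := map_one _

theorem basisElt_mul (s t : S) : basisElt (s * t) = basisElt s * basisElt t := map_mul _ _ _

namespace MonoidRing

theorem induction {p : MonoidRing S → Prop} (x : MonoidRing S) (hb : ∀ s, p (basisElt s))
    (h0 : p 0) (ha : ∀ x y, p x → p y → p (x + y)) (hn : ∀ x, p x → p (-x)) : p x := by
  refine MonoidAlgebra.induction_on x hb ha fun r x hx => ?_
  induction r using Int.induction_on with
  | zero => rwa [zero_smul]
  | succ n ih => rw [add_smul, one_smul]; exact ha _ _ ih hx
  | pred n ih => rw [sub_smul, one_smul, sub_eq_add_neg]; exact ha _ _ ih (hn _ hx)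

/-- The additive map on `ℤS` with prescribed values on `S`. -/
noncomputable def extend {A : Type*} [AddCommGroup A] (f : S → A) : MonoidRing S →+ A :=
  (Finsupp.liftAddHom fun s => (zmultiplesHom A (f s))).comp
    MonoidAlgebra.coeffAddEquiv.toAddMonoidHom

@[simp]
theorem extend_basisElt {A : Type*} [AddCommGroup A] (f : S → A) (s : S) :
    extend f (basisElt s) = f s := by
  simp [extend]

theorem addHom_eq {A : Type*} [AddCommGroup A] {f g : MonoidRing S →+ A}
    (h : ∀ s, f (basisElt s) = g (basisElt s)) (x : MonoidRing S) : f x = g x := by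
  induction x using MonoidRing.induction with
  | hb s => exact h s
  | h0 => rw [map_zero, map_zero]
  | ha x y hx hy => rw [map_add, map_add, hx, hy]
  | hn x hx => rw [map_neg, map_neg, hx]

/-- An additive map between `ℤS`-modules commuting with the action of `S` is `ℤS`-linear. -/
def linearOfEquivariant {M N : Type*} [AddCommGroup M] [Module (MonoidRing S) M] [AddCommGroup N]
    [Module (MonoidRing S) N] (f : M →+ N)
    (hf : ∀ (s : S) (x : M), f (basisElt s • x) = basisElt s • f x) : M →ₗ[MonoidRing S] N where
  __ := f
  map_smul' r x := by
    induction r using MonoidRing.induction with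
    | hb s => exact hf s x
    | h0 => simp
    | ha a b ha hb => simpa [add_smul] using congrArg₂ (· + ·) ha hb
    | hn a ha => simpa [neg_smul] using ha

/-- The `ℤS`-module structure on an abelian group on which `S` acts by endomorphisms. -/
noncomputable abbrev moduleOfAction {N : Type*} [AddCommGroup N] (ρ : S →* AddMonoid.End N) :
    Module (MonoidRing S) N :=
  Module.compHom N (MonoidAlgebra.lift ℤ (AddMonoid.End N) S ρ).toRingHom

theorem basisElt_smul_of_action {N : Type*} [AddCommGroup N] (ρ : S →* AddMonoid.End N)
    (s : S) (x : N) :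
    (letI := moduleOfAction ρ; basisElt s • x) = ρ s x := by
  change (MonoidAlgebra.lift ℤ (AddMonoid.End N) S ρ (basisElt s)) x = ρ s x
  rw [MonoidAlgebra.lift_of]

end MonoidRing

theorem basisElt_smul_trivial (s : S) (x : TrivialModule S) : basisElt s • x = x := by
  change HMul.hMul (α := ℤ) (β := ℤ) (augmentation S (MonoidAlgebra.of ℤ S s)) x = x
  rw [augmentation_of]
  exact one_mul _

/-- The trivial module `ℤ`, moved to the universe of `S`. -/
abbrev TrivialModuleLift (S : Type u) [Monoid S] : Type u := ULift.{u} (TrivialModule S)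

theorem basisElt_smul_trivialLift (s : S) (x : TrivialModuleLift S) : basisElt s • x = x :=
  ULift.ext _ _ (basisElt_smul_trivial s x.down)

/-- A monoid is of type left-`FP_n` exactly when its trivial module is of type `FP_n`. -/
theorem isLeftFPMonoid_iff (n : ℕ) :
    IsLeftFPMonoid S n ↔ IsFPModule (MonoidRing S) n (TrivialModuleLift S) := by
  let ε : TrivialModuleLift S ≃ₗ[MonoidRing S] TrivialModule S := ULift.moduleEquiv
  constructor
  · rintro ⟨Q, hQ⟩
    refine IsFPModule.of_resolution n Q.A (ε.symm.toLinearMap ∘ₗ Q.aug) Q.d hQ Q.free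
      (ε.symm.surjective.comp Q.aug_surjective) (fun hn x => ?_) Q.exact_succ
    rw [← Q.exact_zero hn x]
    exact ε.symm.map_eq_zero_iff
  · intro h
    obtain ⟨k, aug, d, hs, h0, h1⟩ := IsFPModule.exists_resolution n h
    refine ⟨⟨fun i => Fin (k i) → MonoidRing S, ε.toLinearMap ∘ₗ aug, d, fun _ _ => inferInstance,
      ε.surjective.comp hs, fun hn x => ?_, h1⟩, fun i _ => ?_⟩
    · rw [← h0 hn x]
      exact ε.map_eq_zero_iff
    · exact (inferInstance : Module.Finite (MonoidRing S) (Fin (k i) → MonoidRing S))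

/-- A retract of a finitely generated projective module is finitely generated projective. -/
theorem finite_and_projective_of_retract {R : Type u} [Ring R] {P Q : Type u} [AddCommGroup P] [Module R P]
    [AddCommGroup Q] [Module R Q] [Module.Finite R Q] [Module.Projective R Q]
    (s : P →ₗ[R] Q) (t : Q →ₗ[R] P) (h : ∀ x, t (s x) = x) :
    Module.Finite R P ∧ Module.Projective R P :=
  ⟨Module.Finite.of_surjective t fun x => ⟨s x, h x⟩,
    Module.Projective.of_split s t (LinearMap.ext h)⟩

end MonoidRing

/-! ### Restriction to a local subgroup -/

section FixedPart

open Function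

variable {S : Type u} [Monoid S] {H : Type u} [Group H] (φ : H →ₙ* S)

theorem map_mul_one (h : H) : φ h * φ 1 = φ h := by rw [← map_mul, mul_one]

theorem map_one_mul (h : H) : φ 1 * φ h = φ h := by rw [← map_mul, one_mul]

/-- The subgroup `eM` of a `ℤS`-module `M`, where `e = φ 1`. -/
def fixedAddSubgroup (M : Type u) [AddCommGroup M] [Module (MonoidRing S) M] : AddSubgroup M where
  carrier := {m | basisElt (φ 1) • m = m}
  zero_mem' := smul_zero _
  add_mem' {a b} ha hb := by
    change _ • (a + b) = a + b
    rw [smul_add, ha, hb]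
  neg_mem' {a} ha := by
    change _ • (-a) = -a
    rw [smul_neg, ha]

/-- The `ℤH`-module `eM` of a `ℤS`-module `M`, for a group `H` embedded in `S` by `φ` with identity
`e = φ 1`. -/
def FixedPart (M : Type u) [AddCommGroup M] [Module (MonoidRing S) M] : Type u :=
  fixedAddSubgroup φ M

variable (M : Type u) [AddCommGroup M] [Module (MonoidRing S) M]
  {N : Type u} [AddCommGroup N] [Module (MonoidRing S) N]

instance : AddCommGroup (FixedPart φ M) := inferInstanceAs (AddCommGroup (fixedAddSubgroup φ M))

/-- The action of `H` on `eM`. -/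
noncomputable def fixedAction : H →* AddMonoid.End (FixedPart φ M) where
  toFun h :=
    { toFun := fun m => ⟨basisElt (φ h) • m.1, by
        change basisElt (φ 1) • basisElt (φ h) • m.1 = basisElt (φ h) • m.1
        rw [smul_smul, ← map_mul, map_one_mul]⟩
      map_zero' := Subtype.ext (smul_zero _)
      map_add' := fun a b => Subtype.ext (smul_add _ _ _) }
  map_one' := AddMonoidHom.ext fun m => Subtype.ext m.2
  map_mul' g h := AddMonoidHom.ext fun m => Subtype.ext <| by
    change basisElt (φ (g * h)) • m.1 = basisElt (φ g) • basisElt (φ h) • m.1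
    rw [smul_smul, ← map_mul, map_mul]

noncomputable instance : Module (MonoidRing H) (FixedPart φ M) :=
  MonoidRing.moduleOfAction (fixedAction φ M)

variable {M}

theorem FixedPart.val_smul (h : H) (m : FixedPart φ M) :
    (basisElt h • m).1 = basisElt (φ h) • m.1 :=
  congrArg Subtype.val (MonoidRing.basisElt_smul_of_action (fixedAction φ M) h m)

/-- The map `eM → eN` induced by a map `M → N`. -/
noncomputable def fixedMap (f : M →ₗ[MonoidRing S] N) : FixedPart φ M →ₗ[MonoidRing H] FixedPart φ N :=
  MonoidRing.linearOfEquivariant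
    { toFun := fun m => ⟨f m.1, by
        change basisElt (φ 1) • f m.1 = f m.1
        rw [← map_smul]
        exact congrArg f m.2⟩
      map_zero' := Subtype.ext (map_zero f)
      map_add' := fun a b => Subtype.ext (map_add f _ _) }
    (fun h m => Subtype.ext <| by
      rw [FixedPart.val_smul]
      change f (basisElt h • m).1 = basisElt (φ h) • f m.1
      rw [FixedPart.val_smul, map_smul])

theorem fixedMap_injective {f : M →ₗ[MonoidRing S] N} (hf : Injective f) :
    Injective (fixedMap φ f) :=
  fun _ _ hab => Subtype.ext (hf (congrArg Subtype.val hab))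

theorem fixedMap_surjective {f : M →ₗ[MonoidRing S] N} (hf : Surjective f) :
    Surjective (fixedMap φ f) := by
  rintro ⟨y, hy⟩
  obtain ⟨x, rfl⟩ := hf y
  have hx : basisElt (φ 1) • basisElt (φ 1) • x = basisElt (φ 1) • x := by
    rw [smul_smul, ← map_mul, map_one_mul]
  exact ⟨⟨basisElt (φ 1) • x, hx⟩, Subtype.ext ((map_smul f _ _).trans hy)⟩

theorem fixedMap_exact {K : Type u} [AddCommGroup K] [Module (MonoidRing S) K]
    {i : K →ₗ[MonoidRing S] M} {f : M →ₗ[MonoidRing S] N} (hi : Injective i) (hif : Exact i f) :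
    Exact (fixedMap φ i) (fixedMap φ f) := by
  intro x
  constructor
  · intro h
    obtain ⟨y, hy⟩ := (hif x.1).mp (congrArg Subtype.val h)
    refine ⟨⟨y, hi ?_⟩, Subtype.ext hy⟩
    rw [map_smul, hy]
    exact x.2
  · rintro ⟨y, rfl⟩
    exact Subtype.ext (hif.apply_apply_eq_zero y.1)

/-- If `e(ℤS)ᵏ` is finitely generated projective over `ℤH` for every `k`, then `M ↦ eM` preserves
type `FP_n`. -/
theorem IsFPModule.fixedPart
    (hS : ∀ k : ℕ, Module.Finite (MonoidRing H) (FixedPart φ (Fin k → MonoidRing S)) ∧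
      Module.Projective (MonoidRing H) (FixedPart φ (Fin k → MonoidRing S)))
    (n : ℕ) : ∀ {M : Type u} [AddCommGroup M] [Module (MonoidRing S) M],
    IsFPModule (MonoidRing S) n M → IsFPModule (MonoidRing H) n (FixedPart φ M) := by
  induction n with
  | zero =>
    intro M _ _ h
    have : Module.Finite (MonoidRing S) M := h
    obtain ⟨k, f, hf⟩ := Module.Finite.exists_fin' (MonoidRing S) M
    have := (hS k).1
    exact Module.Finite.of_surjective _ (fixedMap_surjective φ hf)
  | succ n ih =>
    intro M _ _ h
    obtain ⟨k, f, hf, hk⟩ := h.exists_free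
    have := (hS k).1
    have := (hS k).2
    exact IsFPModule.of_exact (fixedMap φ (LinearMap.ker f).subtype) (fixedMap φ f)
      (fixedMap_injective φ (Submodule.subtype_injective _))
      (fixedMap_exact φ (Submodule.subtype_injective _) (LinearMap.exact_subtype_ker_map f))
      (fixedMap_surjective φ hf) (ih hk)

/-- The additive map `ℤH → ℤS` induced by `φ`. It does not preserve `1`. -/
noncomputable def ringMap : MonoidRing H →+ MonoidRing S :=
  MonoidRing.extend fun h => basisElt (φ h)

theorem ringMap_basisElt (h : H) : ringMap φ (basisElt h) = basisElt (φ h) :=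
  MonoidRing.extend_basisElt _ _

theorem ringMap_basisElt_mul (h : H) (x : MonoidRing H) :
    ringMap φ (basisElt h * x) = basisElt (φ h) * ringMap φ x := by
  refine MonoidRing.addHom_eq (f := (ringMap φ).comp (AddMonoidHom.mulLeft (basisElt h)))
    (g := (AddMonoidHom.mulLeft (basisElt (φ h))).comp (ringMap φ)) (fun s => ?_) x
  simp only [AddMonoidHom.comp_apply, AddMonoidHom.coe_mulLeft, ← map_mul, ringMap_basisElt]

/-- A transversal of the `H`-orbits in `eS`, where `H` acts by left multiplication: every `e * s`
is uniquely a product `φ h * rep l`. -/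
structure OrbitTransversal (Λ : Type u) where
  /-- the representatives of the orbits -/
  rep : Λ → S
  /-- the orbit of `e * s` -/
  idx : S → Λ
  /-- the element of `H` moving the representative to `e * s` -/
  coef : S → H
  map_coef_mul_rep : ∀ s, φ (coef s) * rep (idx s) = φ 1 * s
  idx_mul : ∀ h l, idx (φ h * rep l) = l
  coef_mul : ∀ h l, coef (φ h * rep l) = h

namespace OrbitTransversal

variable {φ} {Λ : Type u} (C : OrbitTransversal φ Λ)

theorem map_mul_eq (h : H) (s : S) : φ h * s = φ (h * C.coef s) * C.rep (C.idx s) := by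
  rw [map_mul, mul_assoc, C.map_coef_mul_rep, ← mul_assoc, map_mul_one]

theorem idx_map_mul (h : H) (s : S) : C.idx (φ h * s) = C.idx s := by
  rw [C.map_mul_eq, C.idx_mul]

theorem coef_map_mul (h : H) (s : S) : C.coef (φ h * s) = h * C.coef s := by
  rw [C.map_mul_eq, C.coef_mul]


open Classical in
/-- The coordinates of `e * x` with respect to the transversal. -/
noncomputable def coord : MonoidRing S →+ (Λ → MonoidRing H) :=
  MonoidRing.extend fun s => Pi.single (C.idx s) (basisElt (C.coef s))

open Classical in
theorem coord_basisElt (s : S) :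
    C.coord (basisElt s) = Pi.single (C.idx s) (basisElt (C.coef s)) :=
  MonoidRing.extend_basisElt _ _

theorem coord_basisElt_mul (h : H) (x : MonoidRing S) :
    C.coord (basisElt (φ h) * x) = basisElt h • C.coord x := by
  classical
  refine MonoidRing.addHom_eq (f := C.coord.comp (AddMonoidHom.mulLeft (basisElt (φ h))))
    (g := (DistribSMul.toAddMonoidHom _ (basisElt h)).comp C.coord) (fun s => ?_) x
  simp only [AddMonoidHom.comp_apply, AddMonoidHom.coe_mulLeft, ← map_mul,
    DistribSMul.toAddMonoidHom_apply]
  rw [C.coord_basisElt, C.coord_basisElt, C.idx_map_mul, C.coef_map_mul, ← Pi.single_smul,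
    smul_eq_mul, ← map_mul]

variable [Fintype Λ]

/-- The element of `ℤS` with given coordinates. -/
noncomputable def ofCoord : (Λ → MonoidRing H) →+ MonoidRing S :=
  ∑ l, (AddMonoidHom.mulRight (basisElt (C.rep l))).comp
    ((ringMap φ).comp (Pi.evalAddMonoidHom _ l))

theorem ofCoord_apply (y : Λ → MonoidRing H) :
    C.ofCoord y = ∑ l, ringMap φ (y l) * basisElt (C.rep l) := by
  simp [ofCoord]

theorem ofCoord_smul (h : H) (y : Λ → MonoidRing H) :
    C.ofCoord (basisElt h • y) = basisElt (φ h) * C.ofCoord y := by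
  simp only [C.ofCoord_apply, Finset.mul_sum, Pi.smul_apply, smul_eq_mul, ringMap_basisElt_mul,
    mul_assoc]

theorem ofCoord_coord (x : MonoidRing S) : C.ofCoord (C.coord x) = basisElt (φ 1) * x := by
  classical
  refine MonoidRing.addHom_eq (f := C.ofCoord.comp C.coord)
    (g := AddMonoidHom.mulLeft (basisElt (φ 1))) (fun s => ?_) x
  rw [AddMonoidHom.comp_apply, C.coord_basisElt, C.ofCoord_apply,
    Finset.sum_eq_single (C.idx s) (fun l _ hl => by rw [Pi.single_eq_of_ne hl]; simp) (by simp),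
    Pi.single_eq_same, ringMap_basisElt, ← map_mul, C.map_coef_mul_rep, map_mul]
  rfl

/-- `e(ℤS)ᵏ` is a retract of a free `ℤH`-module of rank `k * |Λ|`. -/
theorem finite_and_projective {Λ : Type u} [Fintype Λ] (C : OrbitTransversal φ Λ) (k : ℕ) :
    Module.Finite (MonoidRing H) (FixedPart φ (Fin k → MonoidRing S)) ∧
      Module.Projective (MonoidRing H) (FixedPart φ (Fin k → MonoidRing S)) := by
  let s : FixedPart φ (Fin k → MonoidRing S) →ₗ[MonoidRing H] (Fin k → Λ → MonoidRing H) :=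
    MonoidRing.linearOfEquivariant
      { toFun := fun x j => C.coord (x.1 j)
        map_zero' := funext fun j => map_zero _
        map_add' := fun x y => funext fun j => map_add _ _ _ }
      (fun h x => funext fun j => by
        change C.coord ((basisElt h • x).1 j) = basisElt h • C.coord (x.1 j)
        rw [FixedPart.val_smul, ← C.coord_basisElt_mul]
        rfl)
  let t : (Fin k → Λ → MonoidRing H) →ₗ[MonoidRing H] FixedPart φ (Fin k → MonoidRing S) :=
    MonoidRing.linearOfEquivariant
      { toFun := fun y => ⟨fun j => C.ofCoord (y j), funext fun j => by
          change basisElt (φ 1) * C.ofCoord (y j) = C.ofCoord (y j)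
          rw [← C.ofCoord_smul, basisElt_one, one_smul]⟩
        map_zero' := Subtype.ext (funext fun j => map_zero _)
        map_add' := fun x y => Subtype.ext (funext fun j => map_add _ _ _) }
      (fun h y => Subtype.ext <| by
        rw [FixedPart.val_smul]
        exact funext fun j => C.ofCoord_smul h (y j))
  refine finite_and_projective_of_retract s t fun x => Subtype.ext (funext fun j => ?_)
  change C.ofCoord (C.coord (x.1 j)) = x.1 j
  rw [C.ofCoord_coord]
  exact congrFun x.2 j

end OrbitTransversal

/-- If `eS` is a union of finitely many `H`-orbits, freely permuted by `H`, and `S` is of type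
left-`FP_n`, then so is `H`. -/
theorem OrbitTransversal.isLeftFPMonoid {φ : H →ₙ* S} {Λ : Type u} [Finite Λ]
    (C : OrbitTransversal φ Λ) {n : ℕ} (h : IsLeftFPMonoid S n) : IsLeftFPMonoid H n := by
  have := Fintype.ofFinite Λ
  rw [isLeftFPMonoid_iff] at h ⊢
  refine (IsFPModule.fixedPart φ C.finite_and_projective n h).of_equiv ?_
  refine LinearEquiv.ofBijective (MonoidRing.linearOfEquivariant
    { toFun := fun x => ULift.up x.1.down
      map_zero' := rfl
      map_add' := fun _ _ => rfl } (fun h x => ?_)) ⟨?_, ?_⟩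
  · rw [basisElt_smul_trivialLift]
    change ULift.up (basisElt h • x).1.down = _
    rw [FixedPart.val_smul, basisElt_smul_trivialLift]
    rfl
  · intro x y hxy
    exact Subtype.ext (ULift.ext _ _ (congrArg ULift.down hxy))
  · intro x
    exact ⟨⟨ULift.up x.down, basisElt_smul_trivialLift _ _⟩, rfl⟩

end FixedPart

/-! ### Induction from a local subgroup -/

section Induced

open Function

variable {S : Type u} [Monoid S] {H : Type u} [Group H] (φ : H →ₙ* S)

/-- A transversal of the `H`-orbits in `Se`, where `H` acts by right multiplication: every `s * e`
is uniquely a product `rep i * φ h`. -/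
structure RightTransversal (I : Type u) where
  /-- the representatives of the orbits -/
  rep : I → S
  /-- the orbit of `s * e` -/
  idx : S → I
  /-- the element of `H` moving the representative to `s * e` -/
  coef : S → H
  rep_mul_map_coef : ∀ s, rep (idx s) * φ (coef s) = s * φ 1
  rep_mul_map_one : ∀ i, rep i * φ 1 = rep i
  idx_mul : ∀ i h, idx (rep i * φ h) = i
  coef_mul : ∀ i h, coef (rep i * φ h) = h

namespace RightTransversal

variable {φ} {I : Type u} (C : RightTransversal φ I)

theorem mul_map_eq (s : S) (h : H) : s * φ h = C.rep (C.idx s) * φ (C.coef s * h) := by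
  rw [map_mul, ← mul_assoc, C.rep_mul_map_coef, mul_assoc, map_one_mul]

theorem idx_mul_map (s : S) (h : H) : C.idx (s * φ h) = C.idx s := by
  rw [C.mul_map_eq, C.idx_mul]

theorem coef_mul_map (s : S) (h : H) : C.coef (s * φ h) = C.coef s * h := by
  rw [C.mul_map_eq, C.coef_mul]

theorem mul_rep (s : S) (i : I) :
    s * C.rep i = C.rep (C.idx (s * C.rep i)) * φ (C.coef (s * C.rep i)) := by
  rw [C.rep_mul_map_coef, mul_assoc, C.rep_mul_map_one]

theorem idx_mul_mul_rep (s t : S) (i : I) :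
    C.idx (s * t * C.rep i) = C.idx (s * C.rep (C.idx (t * C.rep i))) := by
  rw [mul_assoc, C.mul_rep t, ← mul_assoc, C.idx_mul_map, ← C.mul_rep t]

theorem coef_mul_mul_rep (s t : S) (i : I) :
    C.coef (s * t * C.rep i) =
      C.coef (s * C.rep (C.idx (t * C.rep i))) * C.coef (t * C.rep i) := by
  rw [mul_assoc, C.mul_rep t, ← mul_assoc, C.coef_mul_map, ← C.mul_rep t]

/-- The `ℤS`-module `ℤ(Se) ⊗ N` induced from a `ℤH`-module `N`. A transversal of `Se / H` identifies
it with a direct sum of copies of `N`, on which `S` acts by monomial matrices. -/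
def Induced (_C : RightTransversal φ I) (N : Type u) [AddCommGroup N] : Type u := I →₀ N

variable {N : Type u} [AddCommGroup N]

noncomputable instance : AddCommGroup (C.Induced N) := inferInstanceAs (AddCommGroup (I →₀ N))

variable (N) in
/-- The inclusion of the `i`-th summand into the induced module. -/
noncomputable def single (i : I) : N →+ C.Induced N := Finsupp.singleAddHom i

/-- The additive map out of the induced module with given components. -/
noncomputable def lift {A : Type u} [AddCommGroup A] (f : I → N →+ A) : C.Induced N →+ A :=
  Finsupp.liftAddHom f

@[simp]
theorem lift_single {A : Type u} [AddCommGroup A] (f : I → N →+ A) (i : I) (x : N) :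
    C.lift f (C.single N i x) = f i x :=
  Finsupp.liftAddHom_apply_single f i x

theorem addHom_ext {A : Type u} [AddCommGroup A] {f g : C.Induced N →+ A}
    (h : ∀ i x, f (C.single N i x) = g (C.single N i x)) : f = g :=
  Finsupp.addHom_ext h

/-- The `i`-th component of an element of the induced module. -/
noncomputable def component (i : I) : C.Induced N →+ N := Finsupp.applyAddHom i

theorem ext_component {x y : C.Induced N} (h : ∀ i, C.component i x = C.component i y) : x = y :=
  Finsupp.ext h

variable {N' : Type u} [Module (MonoidRing H) N] [AddCommGroup N'] [Module (MonoidRing H) N']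

variable (N) in
/-- The action of `S` on the induced module. -/
noncomputable def inducedAction : S →* AddMonoid.End (C.Induced N) where
  toFun s := C.lift fun i => (C.single N (C.idx (s * C.rep i))).comp
    (DistribSMul.toAddMonoidHom N (basisElt (C.coef (s * C.rep i))))
  map_one' := C.addHom_ext fun i x => by
    have h1 : C.idx (1 * C.rep i) = i := by
      rw [one_mul, ← C.rep_mul_map_one, C.idx_mul]
    have h2 : C.coef (1 * C.rep i) = 1 := by
      rw [one_mul, ← C.rep_mul_map_one, C.coef_mul]
    rw [C.lift_single, h1, h2]
    change C.single N i (basisElt (1 : H) • x) = C.single N i x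
    rw [basisElt_one, one_smul]
  map_mul' s t := C.addHom_ext fun i x => by
    change _ = C.lift _ (C.lift _ (C.single N i x))
    rw [C.lift_single, C.lift_single]
    simp only [AddMonoidHom.comp_apply, DistribSMul.toAddMonoidHom_apply]
    rw [C.lift_single]
    simp only [AddMonoidHom.comp_apply, DistribSMul.toAddMonoidHom_apply]
    rw [C.idx_mul_mul_rep, C.coef_mul_mul_rep, basisElt_mul, mul_smul]

noncomputable instance : Module (MonoidRing S) (C.Induced N) :=
  MonoidRing.moduleOfAction (C.inducedAction N)

theorem basisElt_smul_single (s : S) (i : I) (x : N) :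
    basisElt s • C.single N i x =
      C.single N (C.idx (s * C.rep i)) (basisElt (C.coef (s * C.rep i)) • x) :=
  (MonoidRing.basisElt_smul_of_action (C.inducedAction N) s _).trans (C.lift_single _ _ _)

/-- An additive map out of the induced module is `ℤS`-linear if it is equivariant on the
summands. -/
noncomputable def liftLinear {A : Type u} [AddCommGroup A] [Module (MonoidRing S) A]
    (f : I → N →+ A) (hf : ∀ s i x,
      f (C.idx (s * C.rep i)) (basisElt (C.coef (s * C.rep i)) • x) = basisElt s • f i x) :
    C.Induced N →ₗ[MonoidRing S] A :=
  MonoidRing.linearOfEquivariant (C.lift f) fun s x => by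
    refine DFunLike.congr_fun (f := (C.lift f).comp (DistribSMul.toAddMonoidHom _ (basisElt s)))
      (g := (DistribSMul.toAddMonoidHom _ (basisElt s)).comp (C.lift f))
      (C.addHom_ext fun i x => ?_) x
    simp only [AddMonoidHom.comp_apply, DistribSMul.toAddMonoidHom_apply]
    rw [C.basisElt_smul_single, C.lift_single, C.lift_single, hf]

theorem liftLinear_single {A : Type u} [AddCommGroup A] [Module (MonoidRing S) A]
    (f : I → N →+ A) (hf : ∀ s i x,
      f (C.idx (s * C.rep i)) (basisElt (C.coef (s * C.rep i)) • x) = basisElt s • f i x)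
    (i : I) (x : N) : C.liftLinear f hf (C.single N i x) = f i x :=
  C.lift_single f i x

/-- The map of induced modules coming from a map of `ℤH`-modules. -/
noncomputable def inducedMap (f : N →ₗ[MonoidRing H] N') :
    C.Induced N →ₗ[MonoidRing S] C.Induced N' :=
  C.liftLinear (fun i => (C.single N' i).comp f.toAddMonoidHom) fun s i x => by
    change C.single N' _ (f _) = _ • C.single N' i (f x)
    rw [map_smul, C.basisElt_smul_single]

theorem component_inducedMap (f : N →ₗ[MonoidRing H] N') (x : C.Induced N) (i : I) :
    C.component i (C.inducedMap f x) = f (C.component i x) := by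
  refine DFunLike.congr_fun (f := (C.component i).comp (C.inducedMap f).toAddMonoidHom)
    (g := f.toAddMonoidHom.comp (C.component i)) (C.addHom_ext fun j x => ?_) x
  change C.component i (C.lift _ (C.single N j x)) = f (C.component i (C.single N j x))
  rw [C.lift_single]
  classical
  change Finsupp.single j (f x) i = f (Finsupp.single j x i)
  rw [Finsupp.single_apply, Finsupp.single_apply]
  split_ifs
  · rfl
  · rw [map_zero]

/-- Preimages chosen component by component assemble to a preimage in the induced module. -/
theorem mem_range_inducedMap {f : N →ₗ[MonoidRing H] N'} {x : C.Induced N'}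
    (hx : ∀ i, ∃ y, f y = C.component i x) : ∃ y, C.inducedMap f y = x := by
  classical
  choose g hg using hx
  let y : C.Induced N := Finsupp.onFinset (Finsupp.support (M := N') x)
    (fun j => if C.component j x = 0 then 0 else g j)
    (fun j hj => Finsupp.mem_support_iff.mpr fun h0 => hj (if_pos h0))
  refine ⟨y, C.ext_component fun j => ?_⟩
  rw [C.component_inducedMap]
  change f (if C.component j x = 0 then 0 else g j) = _
  split_ifs with h0
  · rw [map_zero, h0]
  · exact hg j

theorem inducedMap_injective {f : N →ₗ[MonoidRing H] N'} (hf : Injective f) :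
    Injective (C.inducedMap f) := by
  intro x y hxy
  refine C.ext_component fun i => hf ?_
  rw [← C.component_inducedMap, ← C.component_inducedMap, hxy]

theorem inducedMap_surjective {f : N →ₗ[MonoidRing H] N'} (hf : Surjective f) :
    Surjective (C.inducedMap f) :=
  fun _ => C.mem_range_inducedMap fun _ => hf _

theorem inducedMap_exact {K : Type u} [AddCommGroup K] [Module (MonoidRing H) K]
    {i : K →ₗ[MonoidRing H] N} {f : N →ₗ[MonoidRing H] N'} (hif : Exact i f) :
    Exact (C.inducedMap i) (C.inducedMap f) := by
  intro x
  constructor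
  · intro h
    refine C.mem_range_inducedMap fun j => (hif _).mp ?_
    rw [← C.component_inducedMap, h, map_zero]
  · rintro ⟨y, rfl⟩
    refine C.ext_component fun j => ?_
    rw [C.component_inducedMap, C.component_inducedMap, hif.apply_apply_eq_zero, map_zero]

/-- The element `e ∈ Se`, placed in the `j`-th coordinate, generates the `j`-th copy of `ℤ(Se)`: the
element `rep i * φ h` of `ℤS` carries it to `rep i ⊗ h`. -/
theorem ringMap_mul_smul_single (i : I) (k : ℕ) (j : Fin k) (z : MonoidRing H) :
    (basisElt (C.rep i) * ringMap φ z) •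
      C.single (Fin k → MonoidRing H) (C.idx 1) (Pi.single j (basisElt (C.coef 1))) =
    C.single (Fin k → MonoidRing H) i (Pi.single j z) := by
  induction z using MonoidRing.induction with
  | hb h =>
    have key : C.rep i * φ h * C.rep (C.idx 1) * φ (C.coef 1) = C.rep i * φ h := by
      rw [mul_assoc, C.rep_mul_map_coef, one_mul, mul_assoc, map_mul_one]
    have h1 := C.idx_mul_map (C.rep i * φ h * C.rep (C.idx 1)) (C.coef 1)
    have h2 := C.coef_mul_map (C.rep i * φ h * C.rep (C.idx 1)) (C.coef 1)
    rw [key, C.idx_mul] at h1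
    rw [key, C.coef_mul] at h2
    rw [ringMap_basisElt, ← map_mul, C.basisElt_smul_single, ← h1, ← Pi.single_smul, smul_eq_mul,
      ← map_mul, ← h2]
  | h0 => simp
  | ha x y hx hy => rw [map_add, mul_add, add_smul, hx, hy, Pi.single_add, map_add]
  | hn x hx => rw [map_neg, mul_neg, neg_smul, hx, Pi.single_neg, map_neg]

/-- The module induced from a free module of rank `k` is a retract of `(ℤS)ᵏ`: it is isomorphic to
`(ℤS e)ᵏ`. -/
theorem finite_and_projective (C : RightTransversal φ I) (k : ℕ) :
    Module.Finite (MonoidRing S) (C.Induced (Fin k → MonoidRing H)) ∧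
      Module.Projective (MonoidRing S) (C.Induced (Fin k → MonoidRing H)) := by
  let s : C.Induced (Fin k → MonoidRing H) →ₗ[MonoidRing S] (Fin k → MonoidRing S) :=
    C.liftLinear
      (fun i =>
        { toFun := fun y j => basisElt (C.rep i) * ringMap φ (y j)
          map_zero' := funext fun j => by simp
          map_add' := fun x y => funext fun j => by simp [mul_add] })
      (fun s i y => funext fun j => by
        change basisElt (C.rep _) * ringMap φ (basisElt _ * y j) =
          basisElt s * (basisElt (C.rep i) * ringMap φ (y j))
        rw [ringMap_basisElt_mul, ← mul_assoc, ← mul_assoc, ← map_mul, ← map_mul, ← C.mul_rep])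
  let t : (Fin k → MonoidRing S) →ₗ[MonoidRing S] C.Induced (Fin k → MonoidRing H) :=
    Fintype.linearCombination (MonoidRing S) fun j =>
      C.single (Fin k → MonoidRing H) (C.idx 1) (Pi.single j (basisElt (C.coef 1)))
  refine finite_and_projective_of_retract s t fun x => ?_
  refine DFunLike.congr_fun (f := (t ∘ₗ s).toAddMonoidHom) (g := AddMonoidHom.id _)
    (C.addHom_ext fun i y => ?_) x
  change t (s (C.single _ i y)) = C.single _ i y
  rw [C.liftLinear_single, Fintype.linearCombination_apply]
  refine (Finset.sum_congr rfl fun j _ => C.ringMap_mul_smul_single i k j (y j)).trans ?_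
  rw [← map_sum, Finset.univ_sum_single]

/-- Induction from `H` to `S` preserves type `FP_n`. -/
theorem isFPModule_induced (n : ℕ) : ∀ {N : Type u} [AddCommGroup N] [Module (MonoidRing H) N],
    IsFPModule (MonoidRing H) n N → IsFPModule (MonoidRing S) n (C.Induced N) := by
  induction n with
  | zero =>
    intro N _ _ h
    have : Module.Finite (MonoidRing H) N := h
    obtain ⟨k, f, hf⟩ := Module.Finite.exists_fin' (MonoidRing H) N
    have := (C.finite_and_projective k).1
    exact Module.Finite.of_surjective _ (C.inducedMap_surjective hf)
  | succ n ih =>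
    intro N _ _ h
    obtain ⟨k, f, hf, hk⟩ := h.exists_free
    have := (C.finite_and_projective k).1
    have := (C.finite_and_projective k).2
    exact IsFPModule.of_exact (C.inducedMap (LinearMap.ker f).subtype) (C.inducedMap f)
      (C.inducedMap_injective (Submodule.subtype_injective _))
      (C.inducedMap_exact (LinearMap.exact_subtype_ker_map f))
      (C.inducedMap_surjective hf) (ih hk)

end RightTransversal

end Induced

/-! ### Monoids obtained by adjoining an identity to a completely simple ideal -/

section SimpleIdeal

open Function

variable {S : Type u} [Monoid S]

/-- `T` is an ideal of `S` with `S = T ∪ {1}`, and in `T` the principal one-sided ideals are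
minimal: `x ∈ x * y * S` and `x ∈ S * y * x` for all `x, y ∈ T`. -/
structure IsSimpleIdeal (T : Set S) : Prop where
  eq_one_or_mem : ∀ s, s = 1 ∨ s ∈ T
  mul_mem_left : ∀ s, ∀ t ∈ T, s * t ∈ T
  mul_mem_right : ∀ s, ∀ t ∈ T, t * s ∈ T
  exists_mul_right : ∀ x ∈ T, ∀ y ∈ T, ∃ z, x = x * y * z
  exists_mul_left : ∀ x ∈ T, ∀ y ∈ T, ∃ z, x = z * (y * x)

/-- The principal left ideal `Ss`. -/
def principalLeft (s : S) : Set S := {x | ∃ y, x = y * s}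

/-- The principal right ideal `sS`. -/
def principalRight (s : S) : Set S := {x | ∃ y, x = s * y}

theorem self_mem_principalLeft (s : S) : s ∈ principalLeft s := ⟨1, (one_mul s).symm⟩

theorem self_mem_principalRight (s : S) : s ∈ principalRight s := ⟨1, (mul_one s).symm⟩

namespace IsSimpleIdeal

variable {T : Set S} (hT : IsSimpleIdeal T)
include hT

theorem principalLeft_mul (s : S) {t : S} (ht : t ∈ T) :
    principalLeft (s * t) = principalLeft t := by
  ext x
  constructor
  · rintro ⟨y, rfl⟩
    exact ⟨y * s, (mul_assoc _ _ _).symm⟩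
  · rintro ⟨y, rfl⟩
    rcases hT.eq_one_or_mem s with rfl | hs
    · exact ⟨y, by rw [one_mul]⟩
    · obtain ⟨z, hz⟩ := hT.exists_mul_left t ht s hs
      exact ⟨y * z, by rw [mul_assoc, ← hz]⟩

theorem principalRight_mul (s : S) {t : S} (ht : t ∈ T) :
    principalRight (t * s) = principalRight t := by
  ext x
  constructor
  · rintro ⟨y, rfl⟩
    exact ⟨s * y, mul_assoc _ _ _⟩
  · rintro ⟨y, rfl⟩
    rcases hT.eq_one_or_mem s with rfl | hs
    · exact ⟨y, by rw [mul_one]⟩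
    · obtain ⟨z, hz⟩ := hT.exists_mul_right t ht s hs
      exact ⟨z * y, by rw [← mul_assoc, ← hz]⟩

theorem exists_mul_eq_self {t : S} (ht : t ∈ T) : ∃ f ∈ T, t * f = t := by
  obtain ⟨z, hz⟩ := hT.exists_mul_right t ht t ht
  exact ⟨t * z, hT.mul_mem_right z t ht, by rw [← mul_assoc, ← hz]⟩

omit hT in
variable (T) in
/-- The left ideal `ℤT` of `ℤS`. -/
noncomputable def ringIdeal : Submodule (MonoidRing S) (MonoidRing S) :=
  Submodule.span (MonoidRing S) (basisElt '' T)

omit hT in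
theorem basisElt_mem_ringIdeal {t : S} (ht : t ∈ T) : basisElt t ∈ ringIdeal T :=
  Submodule.subset_span ⟨t, ht, rfl⟩

/-- `ℤT` is the direct sum of the left ideals `ℤL`, with `L` running over the finitely many
principal left ideals in `T`. Since `L = L f` for some `f ∈ L`, this makes it a retract of a free
module of finite rank. -/
theorem ringIdeal_finite_and_projective (hfin : (principalLeft '' T).Finite) :
    Module.Finite (MonoidRing S) (ringIdeal T) ∧
      Module.Projective (MonoidRing S) (ringIdeal T) := by
  classical
  let Λ := {L : Set S // L ∈ principalLeft '' T}
  have : Finite Λ := hfin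
  have := Fintype.ofFinite Λ
  have hrep : ∀ l : Λ, ∃ f ∈ T, ∀ t, principalLeft t = l.1 → t * f = t := by
    rintro ⟨-, t, ht, rfl⟩
    obtain ⟨f, hf, htf⟩ := hT.exists_mul_eq_self ht
    refine ⟨f, hf, fun t' h => ?_⟩
    obtain ⟨y, rfl⟩ : t' ∈ principalLeft t := h.le (self_mem_principalLeft t')
    rw [mul_assoc, htf]
  choose f hf hmul using hrep
  let s₀ : MonoidRing S →+ (Λ → MonoidRing S) := MonoidRing.extend fun t l =>
    if principalLeft t = l.1 then basisElt t else 0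
  have hs₀ : ∀ t l, s₀ (basisElt t) l = if principalLeft t = l.1 then basisElt t else 0 :=
    fun t l => congrFun (MonoidRing.extend_basisElt _ t) l
  -- `s₀` is linear on `ℤT` because left multiplication preserves principal left ideals in `T`
  have hlin : ∀ x ∈ ringIdeal T, ∀ r : MonoidRing S, s₀ (r * x) = r • s₀ x := by
    intro x hx
    induction hx using Submodule.span_induction with
    | mem x hx =>
      obtain ⟨t, ht, rfl⟩ := hx
      intro r
      refine MonoidRing.addHom_eq (f := s₀.comp (AddMonoidHom.mulRight (basisElt t)))
        (g := (smulAddHom (MonoidRing S) (Λ → MonoidRing S)).flip (s₀ (basisElt t)))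
        (fun s => ?_) r
      change s₀ (basisElt s * basisElt t) = basisElt s • s₀ (basisElt t)
      funext l
      rw [← basisElt_mul, hs₀, Pi.smul_apply, hs₀, hT.principalLeft_mul s ht]
      split_ifs
      · exact basisElt_mul s t
      · exact (smul_zero _).symm
    | zero => intro r; simp
    | add x y _ _ hx hy => intro r; rw [mul_add, map_add, map_add, hx, hy, smul_add]
    | smul a x _ hx => intro r; rw [smul_eq_mul, ← mul_assoc, hx, hx, mul_smul]
  let s : ringIdeal T →ₗ[MonoidRing S] (Λ → MonoidRing S) :=
    { toFun := fun x => s₀ x.1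
      map_add' := fun x y => map_add s₀ _ _
      map_smul' := fun r x => hlin x.1 x.2 r }
  let t : (Λ → MonoidRing S) →ₗ[MonoidRing S] ringIdeal T :=
    Fintype.linearCombination (MonoidRing S) fun l =>
      (⟨basisElt (f l), basisElt_mem_ringIdeal (hf l)⟩ : ringIdeal T)
  have hts : ∀ y, (t y).1 = ∑ l, y l * basisElt (f l) := fun y => by
    rw [Fintype.linearCombination_apply, Submodule.coe_sum]
    rfl
  refine finite_and_projective_of_retract s t fun x => Subtype.ext ?_
  rw [hts]
  obtain ⟨x, hx⟩ := x
  change ∑ l, s₀ x l * basisElt (f l) = x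
  induction hx using Submodule.span_induction with
  | mem x hx =>
    obtain ⟨u, hu, rfl⟩ := hx
    rw [Finset.sum_eq_single (⟨principalLeft u, u, hu, rfl⟩ : Λ)]
    · rw [hs₀, if_pos rfl, ← basisElt_mul, hmul _ u rfl]
    · intro l _ hl
      rw [hs₀, if_neg (fun h => hl (Subtype.ext h.symm)), zero_mul]
    · simp
  | zero => simp
  | add x y _ _ hx hy =>
    simp only [map_add, Pi.add_apply, add_mul, Finset.sum_add_distrib]
    rw [hx, hy]
  | smul a x hx' hx =>
    have hax := hlin x hx' a
    rw [smul_eq_mul, hax]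
    simp only [Pi.smul_apply, smul_eq_mul, mul_assoc]
    rw [← Finset.mul_sum, hx]

theorem basisElt_mul_mem_ringIdeal {t : S} (ht : t ∈ T) (r : MonoidRing S) :
    basisElt t * r ∈ ringIdeal T := by
  induction r using MonoidRing.induction with
  | hb s =>
    rw [← basisElt_mul]
    exact basisElt_mem_ringIdeal (hT.mul_mem_right s t ht)
  | h0 => simp
  | ha x y hx hy => rw [mul_add]; exact add_mem hx hy
  | hn x hx => rw [mul_neg]; exact neg_mem hx

theorem basisElt_smul_quotient {t : S} (ht : t ∈ T) (x : MonoidRing S ⧸ ringIdeal T) :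
    basisElt t • x = 0 := by
  obtain ⟨r, rfl⟩ := Submodule.mkQ_surjective _ x
  rw [← map_smul]
  exact (Submodule.Quotient.mk_eq_zero _).mpr (hT.basisElt_mul_mem_ringIdeal ht r)

/-- The quotient `ℤS / ℤT` is generated by the class of `1` as an abelian group. -/
theorem quotient_finite_int : Module.Finite ℤ (MonoidRing S ⧸ ringIdeal T) := by
  let g : ℤ →ₗ[ℤ] (MonoidRing S ⧸ ringIdeal T) :=
    LinearMap.toSpanSingleton ℤ _ ((ringIdeal T).mkQ 1)
  refine Module.Finite.of_surjective g fun x => ?_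
  obtain ⟨r, rfl⟩ := Submodule.mkQ_surjective _ x
  change (ringIdeal T).mkQ r ∈ LinearMap.range g
  induction r using MonoidRing.induction with
  | hb s =>
    rcases hT.eq_one_or_mem s with rfl | hs
    · exact ⟨1, by rw [LinearMap.toSpanSingleton_apply, one_smul, basisElt_one]⟩
    · rw [Submodule.mkQ_apply, (Submodule.Quotient.mk_eq_zero _).mpr (basisElt_mem_ringIdeal hs)]
      exact zero_mem _
  | h0 => rw [map_zero]; exact zero_mem _
  | ha x y hx hy => rw [map_add]; exact add_mem hx hy
  | hn x hx => rw [map_neg]; exact neg_mem hx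

/-- A module annihilated by `T` whose additive group is finitely generated has type `FP_n` for
every `n`. It is a quotient of a power of `ℤS / ℤT`, which is resolved by `ℤT` and `ℤS`, and the
kernel is again such a module because `ℤ` is noetherian. -/
theorem isFPModule_of_annihilated (hfin : (principalLeft '' T).Finite) (n : ℕ) :
    ∀ {K : Type u} [AddCommGroup K] [Module (MonoidRing S) K] [Module.Finite ℤ K],
    (∀ t ∈ T, ∀ x : K, basisElt t • x = 0) → IsFPModule (MonoidRing S) n K := by
  induction n with
  | zero =>
    intro K _ _ _ _
    exact Module.Finite.of_restrictScalars_finite ℤ (MonoidRing S) K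
  | succ n ih =>
    intro K _ _ _ hK
    have hJ := hT.ringIdeal_finite_and_projective hfin
    have := hJ.1
    have := hJ.2
    have := hT.quotient_finite_int
    obtain ⟨k, c, hc⟩ := Module.Finite.exists_fin' ℤ K
    let g : Fin k → K := fun j => c (Pi.single j 1)
    let l : ∀ j, (MonoidRing S ⧸ ringIdeal T) →ₗ[MonoidRing S] K := fun j =>
      (ringIdeal T).liftQ (LinearMap.toSpanSingleton (MonoidRing S) K (g j)) <| by
        refine Submodule.span_le.mpr ?_
        rintro - ⟨t, ht, rfl⟩
        exact hK t ht _
    let F : (Fin k → MonoidRing S ⧸ ringIdeal T) →ₗ[MonoidRing S] K :=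
      ∑ j, l j ∘ₗ LinearMap.proj j
    have hF : Surjective F := by
      intro x
      obtain ⟨z, rfl⟩ := hc x
      refine ⟨fun j => (ringIdeal T).mkQ (z j • 1), ?_⟩
      have hz : c z = ∑ j, z j • g j := by
        conv_lhs => rw [← Finset.univ_sum_single z, map_sum]
        refine Finset.sum_congr rfl fun j _ => ?_
        rw [← map_smul, ← Pi.single_smul, smul_eq_mul, mul_one]
      rw [hz, LinearMap.sum_apply]
      refine Finset.sum_congr rfl fun j _ => ?_
      change (z j • (1 : MonoidRing S)) • g j = z j • g j
      rw [smul_assoc, one_smul]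
    have hD : IsFPModule (MonoidRing S) (n + 1) (Fin k → MonoidRing S ⧸ ringIdeal T) := by
      have : Module.Projective (MonoidRing S) (Fin k → ringIdeal T) :=
        Module.Projective.of_equiv (DFinsupp.linearEquivFunOnFintype (R := MonoidRing S)
          (M := fun _ : Fin k => ringIdeal T))
      refine IsFPModule.of_exact (LinearMap.compLeft (ringIdeal T).subtype (Fin k))
        (LinearMap.compLeft (ringIdeal T).mkQ (Fin k)) ?_ ?_ ?_
        (IsFPModule.of_projective (P := Fin k → ringIdeal T) n)
      · intro x y hxy
        exact funext fun j => Subtype.ext (congrFun hxy j)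
      · intro x
        constructor
        · intro h
          exact ⟨fun j => ⟨x j, (Submodule.Quotient.mk_eq_zero _).mp (congrFun h j)⟩, rfl⟩
        · rintro ⟨y, rfl⟩
          exact funext fun j => (Submodule.Quotient.mk_eq_zero _).mpr (y j).2
      · intro y
        choose x hx using fun j => Submodule.mkQ_surjective (ringIdeal T) (y j)
        exact ⟨x, funext hx⟩
    have : Module.Finite ℤ (LinearMap.ker F) :=
      Module.Finite.of_injective (LinearMap.ker F).subtype.toAddMonoidHom.toIntLinearMap
        Subtype.val_injective
    refine IsFPModule.of_quotient_succ (LinearMap.ker F).subtype F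
      (Submodule.subtype_injective _) (LinearMap.exact_subtype_ker_map F) hF (ih ?_) hD
    exact fun t ht x => Subtype.ext (funext fun j => hT.basisElt_smul_quotient ht _)

/-- If the trivial `ℤH`-module is of type `FP_n` then so is the trivial `ℤS`-module: the latter is
the quotient of the module induced from the former by a submodule that `T` annihilates. -/
theorem isLeftFPMonoid_of_rightTransversal {H : Type u} [Group H] {φ : H →ₙ* S} {I : Type u}
    [Finite I] [Nonempty I] (C : RightTransversal φ I) (hC : ∀ t ∈ T, ∀ s, C.idx (t * s) = C.idx t)
    (hfin : (principalLeft '' T).Finite) {n : ℕ} (h : IsLeftFPMonoid H (n + 1)) :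
    IsLeftFPMonoid S (n + 1) := by
  rw [isLeftFPMonoid_iff] at h ⊢
  let up : TrivialModuleLift H →+ TrivialModuleLift S :=
    { toFun := fun x => ULift.up x.down
      map_zero' := rfl
      map_add' := fun _ _ => rfl }
  let σ : C.Induced (TrivialModuleLift H) →ₗ[MonoidRing S] TrivialModuleLift S :=
    C.liftLinear (fun _ => up) fun s i x => by
      rw [basisElt_smul_trivialLift, basisElt_smul_trivialLift]
  have hσ : ∀ i x, σ (C.single _ i x) = up x := fun i x => C.liftLinear_single _ _ i x
  have hann : ∀ t ∈ T, ∀ x : C.Induced (TrivialModuleLift H),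
      basisElt t • x = C.single _ (C.idx t) (ULift.up (σ x).down) := by
    intro t ht x
    refine DFunLike.congr_fun (f := DistribSMul.toAddMonoidHom _ (basisElt t))
      (g := ((C.single (TrivialModuleLift H) (C.idx t)).comp
        { toFun := fun y : TrivialModuleLift S => ULift.up y.down
          map_zero' := rfl
          map_add' := fun _ _ => rfl }).comp σ.toAddMonoidHom) (C.addHom_ext fun i y => ?_) x
    change basisElt t • C.single _ i y = C.single _ (C.idx t) (ULift.up (σ (C.single _ i y)).down)
    rw [C.basisElt_smul_single, hC t ht, basisElt_smul_trivialLift, hσ]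
    rfl
  have : Module.Finite ℤ (C.Induced (TrivialModuleLift H)) := by
    let e : TrivialModuleLift H ≃+ ℤ := AddEquiv.ulift
    let e' : C.Induced (TrivialModuleLift H) ≃+ (I →₀ ℤ) := Finsupp.mapRange.addEquiv e
    exact Module.Finite.equiv e'.symm.toIntLinearEquiv
  have : Module.Finite ℤ (LinearMap.ker σ) :=
    Module.Finite.of_injective (LinearMap.ker σ).subtype.toAddMonoidHom.toIntLinearMap
      Subtype.val_injective
  refine IsFPModule.of_quotient_succ (LinearMap.ker σ).subtype σ (Submodule.subtype_injective _)
    (LinearMap.exact_subtype_ker_map σ) ?_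
    (hT.isFPModule_of_annihilated hfin n fun t ht x => Subtype.ext ?_)
    (C.isFPModule_induced (n + 1) h)
  · intro x
    obtain ⟨i⟩ := ‹Nonempty I›
    exact ⟨C.single _ i (ULift.up x.down), hσ i _⟩
  · change basisElt t • x.1 = 0
    have hx : σ x.1 = 0 := x.2
    rw [hann t ht, hx]
    exact map_zero (C.single (TrivialModuleLift H) (C.idx t))

/-- If `S` is of type left-`FP_1` then it has finitely many principal right ideals. The map
`ℤS → ⨁ ℤ` sending `s` to the basis vector of `sS` turns left multiplication by elements of `T` into
zero on the augmentation ideal, so it maps that ideal into the span of the images of finitely many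
generators; yet the image contains `[sS] - [S]` for every `s`. -/
theorem finite_range_principalRight {n : ℕ} (h : IsLeftFPMonoid S (n + 1)) :
    (Set.range (principalRight (S := S))).Finite := by
  rw [isLeftFPMonoid_iff] at h
  have hker : ∃ G : Finset (MonoidRing S), ∀ x, augmentation S x = 0 ↔
      x ∈ Submodule.span (MonoidRing S) (G : Set (MonoidRing S)) := by
    obtain ⟨k, f, hf, hk⟩ := h.exists_free
    have := Module.finitePresentation_of_surjective f hf (Module.Finite.iff_fg.mp hk.finite)
    let ε : MonoidRing S →ₗ[MonoidRing S] TrivialModuleLift S :=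
      LinearMap.toSpanSingleton (MonoidRing S) _ (ULift.up (1 : ℤ))
    have hε : ∀ x, ε x = ULift.up (augmentation S x) := fun x =>
      ULift.ext _ _ (mul_one (augmentation S x))
    obtain ⟨G, hG⟩ := Module.FinitePresentation.fg_ker ε fun x => ⟨(id x.down : ℤ) • 1, by
      rw [hε]
      refine ULift.ext _ _ ?_
      change augmentation S _ = (id x.down : ℤ)
      rw [map_zsmul, map_one, smul_eq_mul, mul_one]⟩
    refine ⟨G, fun x => ?_⟩
    rw [hG, LinearMap.mem_ker, hε]
    exact (ULift.up_inj (y := (0 : ℤ))).symm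
  obtain ⟨G, hG⟩ := hker
  let ψ : MonoidRing S →+ (Set S →₀ ℤ) :=
    MonoidRing.extend fun s => Finsupp.single (principalRight s) 1
  have hψ : ∀ s, ψ (basisElt s) = Finsupp.single (principalRight s) 1 := fun s =>
    MonoidRing.extend_basisElt _ s
  have hmul : ∀ t ∈ T, ∀ x, augmentation S x = 0 → ψ (basisElt t * x) = 0 := by
    intro t ht x hx
    have := MonoidRing.addHom_eq (f := ψ.comp (AddMonoidHom.mulLeft (basisElt t)))
      (g := (Finsupp.singleAddHom (principalRight t)).comp (augmentation S).toAddMonoidHom)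
      (fun s => by
        change ψ (basisElt t * basisElt s) = Finsupp.single _ (augmentation S (basisElt s))
        rw [← basisElt_mul, hψ, hT.principalRight_mul s ht, augmentation_of]) x
    change ψ (basisElt t * x) = Finsupp.single _ (augmentation S x) at this
    rw [this, hx, Finsupp.single_zero]
  let F : Set (Set S) := ⋃ g ∈ G, ((ψ g).support : Set (Set S))
  have hF : F.Finite := G.finite_toSet.biUnion fun g _ => (ψ g).support.finite_toSet
  have hspan : ∀ x ∈ Submodule.span (MonoidRing S) (G : Set (MonoidRing S)),
      ψ x ∈ Finsupp.supported ℤ ℤ F := by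
    intro x hx
    induction hx using Submodule.span_induction with
    | mem x hx => exact fun i hi => Set.mem_biUnion hx hi
    | zero => rw [map_zero]; exact zero_mem _
    | add x y _ _ hx hy => rw [map_add]; exact add_mem hx hy
    | smul r x hx' hx =>
      induction r using MonoidRing.induction with
      | hb s =>
        rcases hT.eq_one_or_mem s with rfl | hs
        · rwa [basisElt_one, one_smul]
        · rw [smul_eq_mul, hmul s hs x ((hG x).mpr hx')]
          exact zero_mem _
      | h0 => rw [zero_smul, map_zero]; exact zero_mem _
      | ha a b ha hb => rw [add_smul, map_add]; exact add_mem ha hb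
      | hn a ha => rw [neg_smul, map_neg]; exact neg_mem ha
  refine (hF.insert (principalRight 1)).subset ?_
  rintro - ⟨s, rfl⟩
  by_cases hs : principalRight s = principalRight 1
  · exact Set.mem_insert_iff.mpr (Or.inl hs)
  · refine Set.mem_insert_of_mem _ ?_
    have := hspan (basisElt s - basisElt 1) ((hG _).mp (by
      rw [map_sub, augmentation_of, augmentation_of, sub_self]))
    refine this (Finsupp.mem_support_iff.mpr ?_)
    rw [map_sub, hψ, hψ, Finsupp.sub_apply, Finsupp.single_eq_same,
      Finsupp.single_eq_of_ne hs]
    norm_num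

end IsSimpleIdeal

end SimpleIdeal

/-! ### Structure of completely simple semigroups -/

section CompletelySimple

open Function

variable {U : Type u} [Semigroup U]

/-- In a simple semigroup with a minimal right ideal `R`, every element is a product `a * r` with
`r ∈ R`, and `r * y * U = R`. -/
theorem IsCompletelySimple.exists_mul_right (hU : IsCompletelySimple U) (x y : U) :
    ∃ z, x = x * y * z := by
  obtain ⟨⟨⟨u⟩, hs⟩, -, R, ⟨⟨r₀, hr₀⟩, hR⟩, hmin⟩ := hU
  have huniv : {w | ∃ a, ∃ r ∈ R, w = a * r} = Set.univ := by
    refine hs _ ⟨⟨u * r₀, u, r₀, hr₀, rfl⟩, ?_⟩ ⟨⟨u * r₀, u, r₀, hr₀, rfl⟩, ?_⟩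
    · rintro s - ⟨a, r, hr, rfl⟩
      exact ⟨s * a, r, hr, (mul_assoc _ _ _).symm⟩
    · rintro s - ⟨a, r, hr, rfl⟩
      exact ⟨a, r * s, hR s r hr, mul_assoc _ _ _⟩
  obtain ⟨a, r, hr, rfl⟩ := huniv.ge (Set.mem_univ x)
  have hideal : IsRightIdeal {w | ∃ z, w = r * y * z} := by
    refine ⟨⟨r * y * u, u, rfl⟩, ?_⟩
    rintro s - ⟨z, rfl⟩
    exact ⟨z * s, mul_assoc _ _ _⟩
  have hle : {w | ∃ z, w = r * y * z} ≤ R := by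
    rintro - ⟨z, rfl⟩
    exact hR _ _ (hR _ _ hr)
  obtain ⟨z, hz⟩ := hmin hideal hle hr
  exact ⟨z, by rw [mul_assoc a r y, mul_assoc a, ← hz]⟩

/-- The mirror image of `exists_mul_right`, using a minimal left ideal. -/
theorem IsCompletelySimple.exists_mul_left (hU : IsCompletelySimple U) (x y : U) :
    ∃ z, x = z * (y * x) := by
  obtain ⟨⟨⟨u⟩, hs⟩, ⟨L, ⟨⟨r₀, hr₀⟩, hL⟩, hmin⟩, -⟩ := hU
  have huniv : {w | ∃ r ∈ L, ∃ a, w = r * a} = Set.univ := by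
    refine hs _ ⟨⟨r₀ * u, r₀, hr₀, u, rfl⟩, ?_⟩ ⟨⟨r₀ * u, r₀, hr₀, u, rfl⟩, ?_⟩
    · rintro s - ⟨r, hr, a, rfl⟩
      exact ⟨s * r, hL s r hr, a, (mul_assoc _ _ _).symm⟩
    · rintro s - ⟨r, hr, a, rfl⟩
      exact ⟨r, hr, a * s, mul_assoc _ _ _⟩
  obtain ⟨r, hr, a, rfl⟩ := huniv.ge (Set.mem_univ x)
  have hideal : IsLeftIdeal {w | ∃ z, w = z * (y * r)} := by
    refine ⟨⟨u * (y * r), u, rfl⟩, ?_⟩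
    rintro s - ⟨z, rfl⟩
    exact ⟨s * z, (mul_assoc _ _ _).symm⟩
  have hle : {w | ∃ z, w = z * (y * r)} ≤ L := by
    rintro - ⟨z, rfl⟩
    exact hL _ _ (hL _ _ hr)
  obtain ⟨z, hz⟩ := hmin hideal hle hr
  exact ⟨z, by rw [← mul_assoc y, ← mul_assoc z, ← hz]⟩

/-- In a completely simple semigroup the local monoid `eUe` is a group. -/
theorem IsCompletelySimple.isUnit (hU : IsCompletelySimple U) {e : U} (he : IsIdempotentElem e)
    (x : LocalMonoid he) : IsUnit x := by
  obtain ⟨hex, hxe⟩ := (Subsemigroup.mem_corner_iff he).mp x.2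
  have hee : e * e = e := he
  refine isUnit_iff_exists_and_exists.mpr ⟨?_, ?_⟩
  · obtain ⟨z, hz⟩ := hU.exists_mul_right e x.1
    refine ⟨⟨e * z * e, z, rfl⟩, Subtype.ext ?_⟩
    change x.1 * (e * z * e) = e
    rw [← mul_assoc, ← mul_assoc, hxe, ← hex, ← hz, hee]
  · obtain ⟨z, hz⟩ := hU.exists_mul_left e x.1
    refine ⟨⟨e * z * e, z, rfl⟩, Subtype.ext ?_⟩
    change e * z * e * x.1 = e
    rw [mul_assoc, hex, mul_assoc, ← hxe, ← hz, hee]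

variable {S : Type u} [Monoid S] (ι : U →ₙ* S)

theorem IsCompletelySimple.isSimpleIdeal (hU : IsCompletelySimple U)
    (hS : ∀ s, s = 1 ∨ s ∈ Set.range ι) : IsSimpleIdeal (Set.range ι) where
  eq_one_or_mem := hS
  mul_mem_left := by
    rintro s - ⟨u, rfl⟩
    rcases hS s with rfl | ⟨v, rfl⟩
    · exact ⟨u, (one_mul _).symm⟩
    · exact ⟨v * u, map_mul ι _ _⟩
  mul_mem_right := by
    rintro s - ⟨u, rfl⟩
    rcases hS s with rfl | ⟨v, rfl⟩
    · exact ⟨u, (mul_one _).symm⟩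
    · exact ⟨u * v, map_mul ι _ _⟩
  exists_mul_right := by
    rintro - ⟨x, rfl⟩ - ⟨y, rfl⟩
    obtain ⟨z, hz⟩ := hU.exists_mul_right x y
    exact ⟨ι z, by rw [← map_mul, ← map_mul, ← hz]⟩
  exists_mul_left := by
    rintro - ⟨x, rfl⟩ - ⟨y, rfl⟩
    obtain ⟨z, hz⟩ := hU.exists_mul_left x y
    exact ⟨ι z, by rw [← map_mul, ← map_mul, ← hz]⟩

/-- The embedding of a maximal subgroup of `U` into `S`. -/
def maximalSubgroupHom {e : U} (he : IsIdempotentElem e) : MaximalSubgroup he →ₙ* S where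
  toFun h := ι h.1.1
  map_mul' g h := map_mul ι g.1.1 h.1.1

variable {ι}

theorem maximalSubgroupHom_injective (hι : Injective ι) {e : U} (he : IsIdempotentElem e) :
    Injective (maximalSubgroupHom ι he) :=
  fun _ _ h => Units.ext (Subtype.ext (hι h))

theorem IsCompletelySimple.exists_maximalSubgroupHom_eq (hU : IsCompletelySimple U)
    (hS : ∀ s, s = 1 ∨ s ∈ Set.range ι) {e : U} (he : IsIdempotentElem e) (s : S) :
    ∃ h, maximalSubgroupHom ι he h = ι e * s * ι e := by
  have hT := hU.isSimpleIdeal ι hS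
  obtain ⟨u, hu⟩ := hT.mul_mem_left (ι e) _ (hT.mul_mem_right s _ ⟨e, rfl⟩)
  have hee : ι e * ι e = ι e := by rw [← map_mul, he]
  obtain ⟨h, hh⟩ := hU.isUnit he ⟨e * u * e, u, rfl⟩
  refine ⟨h, ?_⟩
  change ι h.1.1 = _
  rw [hh]
  change ι (e * u * e) = _
  rw [map_mul, map_mul, hu, ← mul_assoc, ← mul_assoc, hee, hee]

end CompletelySimple

/-! ### Orbits of a maximal subgroup -/

section Transversal

open Function

variable {S : Type u} [Monoid S] {T : Set S} {H : Type u} [Group H] {φ : H →ₙ* S}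

namespace IsSimpleIdeal

variable (hT : IsSimpleIdeal T)
include hT

/-- The orbits of `H = eSe` on `eS` correspond to the principal left ideals in `T`. -/
theorem nonempty_orbitTransversal (h1 : φ 1 ∈ T) (hinj : Injective φ)
    (hsurj : ∀ s, ∃ h, φ h = φ 1 * s * φ 1) :
    Nonempty (OrbitTransversal φ {L // L ∈ principalLeft '' T}) := by
  have hrep : ∀ l : {L // L ∈ principalLeft '' T}, ∃ t ∈ T, principalLeft t = l.1 := fun l => l.2
  choose r hrT hr using hrep
  let idx : S → {L // L ∈ principalLeft '' T} := fun s =>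
    ⟨principalLeft (φ 1 * s), φ 1 * s, hT.mul_mem_right s _ h1, rfl⟩
  have hcoef : ∀ s, ∃ h, φ h * (φ 1 * r (idx s)) = φ 1 * s := by
    intro s
    obtain ⟨y, hy⟩ : φ 1 * s ∈ principalLeft (r (idx s)) :=
      (hr (idx s)).ge (self_mem_principalLeft _)
    have hy' : φ 1 * s ∈ principalLeft (φ 1 * r (idx s)) := by
      rw [hT.principalLeft_mul _ (hrT _)]
      exact ⟨y, hy⟩
    obtain ⟨y, hy⟩ := hy'
    obtain ⟨h, hh⟩ := hsurj y
    refine ⟨h, ?_⟩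
    have hee : φ 1 * φ 1 = φ 1 := map_mul_one φ 1
    rw [hh, mul_assoc, ← mul_assoc (φ 1) (φ 1), hee, mul_assoc, ← hy, ← mul_assoc, hee]
  choose coef hcoef using hcoef
  have hidx : ∀ h l, idx (φ h * (φ 1 * r l)) = l := fun h l => Subtype.ext <| by
    change principalLeft (φ 1 * (φ h * (φ 1 * r l))) = l.1
    rw [← mul_assoc, hT.principalLeft_mul _ (hT.mul_mem_left _ _ (hrT l)),
      hT.principalLeft_mul _ (hrT l), hr]
  refine ⟨⟨fun l => φ 1 * r l, idx, coef, hcoef, hidx, fun h l => hinj ?_⟩⟩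
  have hc := hcoef (φ h * (φ 1 * r l))
  rw [hidx, ← mul_assoc (φ 1) (φ h), map_one_mul] at hc
  -- cancel `e * r l` on the right, using `e ∈ e * r l * S`
  obtain ⟨z, hz⟩ := hT.exists_mul_right _ h1 _ (hrT l)
  have hc' := congrArg (· * z) hc
  simp only [mul_assoc] at hc' hz
  rwa [← hz, map_mul_one, map_mul_one] at hc'

/-- The orbits of `H = eSe` on `Se` correspond to the principal right ideals in `T`. -/
theorem exists_rightTransversal (h1 : φ 1 ∈ T) (hinj : Injective φ)
    (hsurj : ∀ s, ∃ h, φ h = φ 1 * s * φ 1) :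
    ∃ C : RightTransversal φ {R // R ∈ principalRight '' T},
      ∀ t ∈ T, ∀ s, C.idx (t * s) = C.idx t := by
  have hrep : ∀ i : {R // R ∈ principalRight '' T}, ∃ t ∈ T, principalRight t = i.1 := fun i => i.2
  choose r hrT hr using hrep
  let idx : S → {R // R ∈ principalRight '' T} := fun s =>
    ⟨principalRight (s * φ 1), s * φ 1, hT.mul_mem_left s _ h1, rfl⟩
  have hee : φ 1 * φ 1 = φ 1 := map_mul_one φ 1
  have hcoef : ∀ s, ∃ h, r (idx s) * φ 1 * φ h = s * φ 1 := by
    intro s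
    obtain ⟨y, hy⟩ : s * φ 1 ∈ principalRight (r (idx s)) :=
      (hr (idx s)).ge (self_mem_principalRight _)
    have hy' : s * φ 1 ∈ principalRight (r (idx s) * φ 1) := by
      rw [hT.principalRight_mul _ (hrT _)]
      exact ⟨y, hy⟩
    obtain ⟨y, hy⟩ := hy'
    obtain ⟨h, hh⟩ := hsurj y
    refine ⟨h, ?_⟩
    rw [hh, ← mul_assoc, ← mul_assoc, mul_assoc (r _), hee, ← hy, mul_assoc, hee]
  choose coef hcoef using hcoef
  have hidx : ∀ i h, idx (r i * φ 1 * φ h) = i := fun i h => Subtype.ext <| by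
    change principalRight (r i * φ 1 * φ h * φ 1) = i.1
    rw [mul_assoc, mul_assoc, hT.principalRight_mul _ (hrT i), hr]
  refine ⟨⟨fun i => r i * φ 1, idx, coef, hcoef, fun i => by rw [mul_assoc, hee], hidx,
    fun i h => hinj ?_⟩, fun t ht s => Subtype.ext ?_⟩
  · have hc := hcoef (r i * φ 1 * φ h)
    rw [hidx, mul_assoc _ (φ h), map_mul_one] at hc
    -- cancel `r i * e` on the left, using `e ∈ S * r i * e`
    obtain ⟨z, hz⟩ := hT.exists_mul_left _ h1 _ (hrT i)
    have hc' := congrArg (z * ·) hc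
    simp only [← mul_assoc] at hc' hz
    rwa [← hz, map_one_mul, map_one_mul] at hc'
  · change principalRight (t * s * φ 1) = principalRight (t * φ 1)
    rw [mul_assoc, hT.principalRight_mul _ ht, hT.principalRight_mul _ ht]

end IsSimpleIdeal

end Transversal

/-! ### Counting one-sided ideals, and the criterion -/

section Main

open Function

variable {U : Type u} [Semigroup U] {S : Type u} [Monoid S] {ι : U →ₙ* S}

/-- A principal left ideal of `S` inside the copy of `U` is the image of a left ideal of `U`. -/
theorem finite_principalLeft_image (hT : IsSimpleIdeal (Set.range ι))
    (hfin : {I : Set U | IsLeftIdeal I}.Finite) : (principalLeft '' Set.range ι).Finite := by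
  refine Set.Finite.of_finite_image (f := fun A => ι ⁻¹' A) (hfin.subset ?_) ?_
  · rintro - ⟨-, ⟨-, ⟨u, rfl⟩, rfl⟩, rfl⟩
    refine ⟨⟨u, self_mem_principalLeft _⟩, ?_⟩
    rintro s x ⟨y, hy⟩
    exact ⟨ι s * y, by rw [map_mul, hy, mul_assoc]⟩
  · have hsub : ∀ A ∈ principalLeft '' Set.range ι, A ⊆ Set.range ι := by
      rintro - ⟨t, ht, rfl⟩ - ⟨y, rfl⟩
      exact hT.mul_mem_left y t ht
    exact fun A hA B hB h => (Set.preimage_eq_preimage' (hsub A hA) (hsub B hB)).mp h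

theorem finite_principalRight_image (hT : IsSimpleIdeal (Set.range ι))
    (hfin : {I : Set U | IsRightIdeal I}.Finite) : (principalRight '' Set.range ι).Finite := by
  refine Set.Finite.of_finite_image (f := fun A => ι ⁻¹' A) (hfin.subset ?_) ?_
  · rintro - ⟨-, ⟨-, ⟨u, rfl⟩, rfl⟩, rfl⟩
    refine ⟨⟨u, self_mem_principalRight _⟩, ?_⟩
    rintro s x ⟨y, hy⟩
    exact ⟨y * ι s, by rw [map_mul, hy, mul_assoc]⟩
  · have hsub : ∀ A ∈ principalRight '' Set.range ι, A ⊆ Set.range ι := by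
      rintro - ⟨t, ht, rfl⟩ - ⟨y, rfl⟩
      exact hT.mul_mem_right y t ht
    exact fun A hA B hB h => (Set.preimage_eq_preimage' (hsub A hA) (hsub B hB)).mp h

/-- A right ideal of `U` is determined by the principal right ideals of its elements. -/
theorem finite_rightIdeals (hι : Injective ι) (hS : ∀ s, s = 1 ∨ s ∈ Set.range ι)
    (hfin : (Set.range (principalRight (S := S))).Finite) :
    {I : Set U | IsRightIdeal I}.Finite := by
  refine Set.Finite.of_finite_image (f := fun I => (fun u => principalRight (ι u)) '' I)
    (hfin.finite_subsets.subset ?_) ?_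
  · rintro - ⟨I, -, rfl⟩ - ⟨u, -, rfl⟩
    exact ⟨ι u, rfl⟩
  · have hle : ∀ I J : Set U, IsRightIdeal J → (fun u => principalRight (ι u)) '' I =
        (fun u => principalRight (ι u)) '' J → I ⊆ J := by
      intro I J hJ h u hu
      obtain ⟨v, hv, huv⟩ := h.le ⟨u, hu, rfl⟩
      obtain ⟨y, hy⟩ : ι u ∈ principalRight (ι v) :=
        huv.ge (self_mem_principalRight (ι u))
      rcases hS y with rfl | ⟨w, rfl⟩
      · rw [mul_one] at hy
        exact hι hy ▸ hv
      · rw [← map_mul] at hy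
        exact hι hy ▸ hJ.2 w v hv
    exact fun I hI J hJ h => (hle I J hJ h).antisymm (hle J I hI h.symm)

/-- The criterion for any monoid `S` consisting of a copy of `U` and an identity element, which may
or may not lie in `U`. -/
theorem isLeftFPMonoid_iff_of_completelySimple (hU : IsCompletelySimple U)
    (hleft : {I : Set U | IsLeftIdeal I}.Finite) (ι : U →ₙ* S) (hι : Injective ι)
    (hS : ∀ s, s = 1 ∨ s ∈ Set.range ι) {e : U} (he : IsIdempotentElem e) {n : ℕ} (hn : 1 ≤ n) :
    IsLeftFPMonoid S n ↔
      {I : Set U | IsRightIdeal I}.Finite ∧ IsFPGroup (MaximalSubgroup he) n := by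
  obtain ⟨n, rfl⟩ := Nat.exists_eq_add_of_le' hn
  have hT := hU.isSimpleIdeal ι hS
  have hL := finite_principalLeft_image hT hleft
  have hinj := maximalSubgroupHom_injective hι he
  have hsurj := hU.exists_maximalSubgroupHom_eq hS he
  constructor
  · intro h
    have : Finite {L // L ∈ principalLeft '' Set.range ι} := hL
    obtain ⟨C⟩ := hT.nonempty_orbitTransversal ⟨e, rfl⟩ hinj hsurj
    exact ⟨finite_rightIdeals hι hS (hT.finite_range_principalRight h), C.isLeftFPMonoid h⟩
  · rintro ⟨hright, hH⟩
    have : Finite {R // R ∈ principalRight '' Set.range ι} := finite_principalRight_image hT hright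
    have : Nonempty {R // R ∈ principalRight '' Set.range ι} :=
      ⟨⟨principalRight (ι e), ι e, ⟨e, rfl⟩, rfl⟩⟩
    obtain ⟨C, hC⟩ := hT.exists_rightTransversal ⟨e, rfl⟩ hinj hsurj
    exact hT.isLeftFPMonoid_of_rightTransversal C hC hL hH

end Main

end SemigroupHomology

theorem mainTheorem2 (U : Type u) [Semigroup U]
    (hU : SemigroupHomology.IsCompletelySimple U)
    (hleft : {I : Set U | SemigroupHomology.IsLeftIdeal I}.Finite)
    (e : U) (he : IsIdempotentElem e) (n : ℕ) (hn : 1 ≤ n) :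
    SemigroupHomology.IsLeftFP U n ↔
      {I : Set U | SemigroupHomology.IsRightIdeal I}.Finite ∧
        SemigroupHomology.IsFPGroup (SemigroupHomology.MaximalSubgroup he) n := by
  have hid : ∀ (f : U) (hf : SemigroupHomology.IsTwoSidedIdentity f),
      @SemigroupHomology.IsLeftFPMonoid U (SemigroupHomology.monoidOfIdentity f hf) n ↔
        {I : Set U | SemigroupHomology.IsRightIdeal I}.Finite ∧
          SemigroupHomology.IsFPGroup (SemigroupHomology.MaximalSubgroup he) n := fun f hf =>
    letI := SemigroupHomology.monoidOfIdentity f hf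
    SemigroupHomology.isLeftFPMonoid_iff_of_completelySimple hU hleft
      (⟨id, fun _ _ => rfl⟩ : U →ₙ* U) Function.injective_id (fun s => Or.inr ⟨s, rfl⟩) he hn
  have hone : SemigroupHomology.IsLeftFPMonoid (WithOne U) n ↔
        {I : Set U | SemigroupHomology.IsRightIdeal I}.Finite ∧
          SemigroupHomology.IsFPGroup (SemigroupHomology.MaximalSubgroup he) n :=
    SemigroupHomology.isLeftFPMonoid_iff_of_completelySimple hU hleft WithOne.coeMulHom
      WithOne.coe_injective
      (fun s => WithOne.cases_on s (Or.inl rfl) fun u => Or.inr ⟨u, rfl⟩) he hn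
  constructor
  · rintro (⟨f, hf, h⟩ | ⟨-, h⟩)
    · exact (hid f hf).mp h
    · exact hone.mp h
  · intro h
    by_cases hex : ∃ f : U, SemigroupHomology.IsTwoSidedIdentity f
    · obtain ⟨f, hf⟩ := hex
      exact Or.inl ⟨f, hf, (hid f hf).mpr h⟩
    · exact Or.inr ⟨hex, hone.mpr h⟩
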